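/- **Setting.** Transmitters $i=1,2$ with $M_i$ antennas send, in each use $k=1,\dots,n$ of a real Gaussian channel, the vectors $X_i(k)=V_i^L s_i(k)+V_i^J r_i(k)$. Here $s_i(k)\in\mathbb R^{L_i}$ are the legitimate (coded) symbols, $r_i(k)\in\mathbb R^{J_i}$ are the jamming symbols, $J_1+J_2=N_E$, the precoders $V_i^L,V_i^J$ are fixed, and the columns of $V_i^J$ are linearly independent (for example orthonormal). The messages $W_1,W_2$ are independent and uniform on finite sets, and a stochastic encoder of transmitter $i$ maps $W_i$ to $s_i^n=(s_i(1),\dots,s_i(n))$, with arbitrary symbol law. The jamming symbols are independent centred Gaussian, independent of the rest, with $\mathbb E\|r_i(k)\|^2=\alpha_iP$ (if $J_i>0$) split equally among the $J_i$ symbols, where $\alpha_i>0$ is a constant. The power constraint is $\frac1n\sum_{k}\sum_i\mathbb E\|X_i(k)\|^2\le P$. An eavesdropper with $N_e\le N_E$ antennas receives $Z(k)=\sum_iG_i(k)X_i(k)+n_E(k)$, with independent white Gaussian noise $n_E(k)$ of variance $\sigma^2>0$ per component. The entries of all $G_i(k)$ are i.i.d. (also over $k$), with a continuous distribution $\nu$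 (one without atoms) of finite variance, and independent of everything else. The channel is known to the eavesdropper only. Write $G(k)=(G_1(k),G_2(k))$. Logarithms and information are in the same unit (nats). **Proposition 1 (jamming overwhelms the eavesdropper).** 1. There are a set $A$ of pairs $(G_1,G_2)$ of channel matrices, of probability one, and a function $C(G_1,G_2)$, depending on neither $P$ nor the code, such that for all $n\ge1$ and all realizations $g=(G(1),\dots,G(n))$ with $G(k)\in A$ for every $k$, the following holds. For every $P>0$ and every code of power $P$, $$\frac1nI(s_1^n,s_2^n;Z^n\mid G^n=g)\le\frac1n\sum_{k=1}^n\frac12\log\frac{\det\big(\sigma^2I+\Sigma_k+\Gamma_k\big)}{\det\big(\sigma^2I+\Gamma_k\big)}\le\frac1n\sum_{k=1}^nC(G(k)),$$ where $\Sigma_k$ is the correlation (second-moment) matrix $\mathbb E[u_ku_k^{T}]$ of $u_k=\sum_iG_i(k)V_i^Ls_i(k)$ and $\Gamma_k=\sum_i\frac{\alpha_iP}{J_i}G_i(k)V_i^JV_i^{J\,T}G_i(k)^{T}$ is the covariance matrix of the received jamming. In particular, given $G^n=g$, the largest value of the left side over all codes of length $n$ and power $P$, divided by $\frac12\log P$,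 tends to $0$ as $P\to\infty$. 2. Let $R_e(P)$ be the supremum of $\frac1nI(s_1^n,s_2^n;Z^n,G^n)$ over all $n\ge1$ and all codes of length $n$ and power $P$. Then $R_e(P)/(\frac12\log P)\to0$ as $P\to\infty$. If $\nu$ has a bounded density, then there is a constant $C$ with $R_e(P)\le C$ for all $P>0$. 3. Hence the eavesdropper decodes zero degrees of freedom of the legitimate messages. Let $\varepsilon<1$, and suppose that for all large $P$ some code of power $P$, of some length $n$, lets the eavesdropper decode from $(Z^n,G^n)$, with error probability at most $\varepsilon$, a part of the messages of rate $R(P)$, that is, a function of $(W_1,W_2)$ that is uniformly distributed on $m$ values with $\frac1n\log m=R(P)$. Then $R(P)/(\frac12\log P)\to0$ as $P\to\infty$. -/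

import Mathlib

open MeasureTheory ProbabilityTheory Filter Topology
open scoped NNReal ENNReal

namespace Wiretap

noncomputable section

/-- Mutual information `I(X; Y)` in nats, with values in `[0, ∞]`: the Kullback-Leibler divergence
of the joint law from the product of the marginal laws. -/
def mutualInfo {Ω A B : Type*} [MeasurableSpace Ω] [MeasurableSpace A] [MeasurableSpace B]
    (μ : Measure Ω) (X : Ω → A) (Y : Ω → B) : ℝ≥0∞ :=
  InformationTheory.klDiv (μ.map (fun ω => (X ω, Y ω))) ((μ.map X).prod (μ.map Y))

/-- The signalling scheme of two transmitters with `M 0` and `M 1` antennas that send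
`N_E` dimensions of jamming. Transmitter `i` sends `L i` legitimate and `J i` jamming symbols per
channel use, through the precoders `VL i` and `VJ i`; `α i * P` is its total jamming power when the
transmit power is `P`. The columns of `VJ i` are linearly independent (in particular, they may be
orthonormal). -/
structure JammingScheme (M : Fin 2 → ℕ) (N_E : ℕ) where
  L : Fin 2 → ℕ
  J : Fin 2 → ℕ
  VL : (i : Fin 2) → Matrix (Fin (M i)) (Fin (L i)) ℝ
  VJ : (i : Fin 2) → Matrix (Fin (M i)) (Fin (J i)) ℝ
  α : Fin 2 → ℝ
  J_add : J 0 + J 1 = N_E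
  VJ_linearIndependent : ∀ i, LinearIndependent ℝ (VJ i).col
  α_pos : ∀ i, 0 < α i

/-- A block code of length `n`: transmitter `i` has `card i` messages and a stochastic encoder, which
sends a message to a random block of `n` vectors of `L i` legitimate symbols. (With `card i = 1` the
symbols of transmitter `i` have an arbitrary law, for example an i.i.d. Gaussian one.) -/
structure Code (L : Fin 2 → ℕ) (n : ℕ) where
  card : Fin 2 → ℕ
  card_pos : ∀ i, 0 < card i
  enc : (i : Fin 2) → Kernel (Fin (card i)) (Fin n → Fin (L i) → ℝ)
  markov : ∀ i, IsMarkovKernel (enc i)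

/-- Messages and legitimate symbol blocks of the two transmitters. -/
abbrev Code.Source {L : Fin 2 → ℕ} {n : ℕ} (c : Code L n) : Type :=
  (i : Fin 2) → Fin (c.card i) × (Fin n → Fin (L i) → ℝ)

/-- Joint law of messages and symbols: the messages are uniform, the two transmitters
are independent, and each one encodes its own message. -/
def Code.sourceLaw {L : Fin 2 → ℕ} {n : ℕ} (c : Code L n) : Measure c.Source :=
  Measure.pi fun i => (uniformOn (Set.univ : Set (Fin (c.card i)))) ⊗ₘ (c.enc i)

/-- Jamming symbols of both transmitters over `n` channel uses. -/
abbrev Jam (J : Fin 2 → ℕ) (n : ℕ) : Type := Fin n → (i : Fin 2) → Fin (J i) → ℝ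

/-- Noise or received block at an eavesdropper with `N_e` antennas over `n` channel uses. -/
abbrev Block (N_e n : ℕ) : Type := Fin n → Fin N_e → ℝ

/-- The two channel matrices from the transmitters to the eavesdropper in one channel use,
as families of entries. -/
abbrev Channel (M : Fin 2 → ℕ) (N_e : ℕ) : Type := (i : Fin 2) → Fin N_e → Fin (M i) → ℝ

/-- Law of the channel in one use: all entries are i.i.d. with law `ν`. -/
def channelUseLaw (M : Fin 2 → ℕ) (N_e : ℕ) (ν : Measure ℝ) : Measure (Channel M N_e) :=
  Measure.pi fun _ => Measure.pi fun _ => Measure.pi fun _ => ν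

/-- Law of the channel over `n` uses, independent in time. -/
def channelLaw (M : Fin 2 → ℕ) (N_e n : ℕ) (ν : Measure ℝ) :
    Measure (Fin n → Channel M N_e) :=
  Measure.pi fun _ => channelUseLaw M N_e ν

variable {M : Fin 2 → ℕ} {N_E : ℕ}

/-- Power of one jamming symbol of transmitter `i`: its jamming power `α i * P` is split
equally among its `J i` symbols. -/
def JammingScheme.jamPower (S : JammingScheme M N_E) (P : ℝ) (i : Fin 2) : ℝ :=
  S.α i * P / S.J i

/-- Law of the jamming: independent centred Gaussian symbols. -/
def JammingScheme.jamLaw (S : JammingScheme M N_E) (P : ℝ) (n : ℕ) : Measure (Jam S.J n) :=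
  Measure.pi fun _ => Measure.pi fun i => Measure.pi fun _ =>
    gaussianReal 0 (S.jamPower P i).toNNReal

/-- White Gaussian noise of variance `σ2`. -/
def noiseLaw (σ2 : ℝ≥0) (N_e n : ℕ) : Measure (Block N_e n) :=
  Measure.pi fun _ => Measure.pi fun _ => gaussianReal 0 σ2

/-- Joint law of source, jamming and noise, which are independent. -/
def JammingScheme.law (S : JammingScheme M N_E) (σ2 : ℝ≥0) (N_e : ℕ) (P : ℝ) {n : ℕ}
    (c : Code S.L n) : Measure (c.Source × Jam S.J n × Block N_e n) :=
  c.sourceLaw.prod ((S.jamLaw P n).prod (noiseLaw σ2 N_e n))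

/-- The vector sent by transmitter `i` in use `k`: precoded legitimate plus precoded jamming
symbols. -/
def JammingScheme.sent (S : JammingScheme M N_E) {n : ℕ} (c : Code S.L n)
    (w : c.Source) (r : Jam S.J n) (k : Fin n) (i : Fin 2) : Fin (M i) → ℝ :=
  (S.VL i).mulVec ((w i).2 k) + (S.VJ i).mulVec (r k i)

/-- The power constraint: the total power of the two channel inputs, averaged over the block, is at
most `P`. -/
def JammingScheme.PowerConstraint (S : JammingScheme M N_E) (P : ℝ) {n : ℕ} (c : Code S.L n) :
    Prop :=
  ∫⁻ ω, ENNReal.ofReal (∑ k, ∑ i, ∑ a, (S.sent c ω.1 ω.2 k i a) ^ 2)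
    ∂(c.sourceLaw.prod (S.jamLaw P n)) ≤ ENNReal.ofReal (n * P)

/-- The block received by the eavesdropper when the channel is `g`. -/
def JammingScheme.received (S : JammingScheme M N_E) {N_e n : ℕ} (c : Code S.L n)
    (g : Fin n → Channel M N_e) (ω : c.Source × Jam S.J n × Block N_e n) : Block N_e n :=
  fun k => ∑ i, (Matrix.of (g k i)).mulVec (S.sent c ω.1 ω.2.1 k i) + ω.2.2 k

/-- The legitimate symbol blocks of both transmitters. -/
def Code.symbols {L : Fin 2 → ℕ} {n : ℕ} (c : Code L n) (w : c.Source) :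
    (i : Fin 2) → Fin n → Fin (L i) → ℝ :=
  fun i => (w i).2

/-- The messages of both transmitters. -/
def Code.messages {L : Fin 2 → ℕ} {n : ℕ} (c : Code L n) (w : c.Source) :
    (i : Fin 2) → Fin (c.card i) :=
  fun i => (w i).1

/-- Information rate (nats per channel use) of the eavesdropper about the legitimate symbols, given
the realization `g` of its channel over the block. -/
def JammingScheme.rateGiven (S : JammingScheme M N_E) (σ2 : ℝ≥0) {N_e n : ℕ} (P : ℝ)
    (c : Code S.L n) (g : Fin n → Channel M N_e) : ℝ≥0∞ :=
  mutualInfo (S.law σ2 N_e P c) (fun ω => c.symbols ω.1) (S.received c g) / n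

/-- The same rate for the random channel, which only the eavesdropper knows:
what the eavesdropper observes is the received block together with the channel block. -/
def JammingScheme.rate (S : JammingScheme M N_E) (σ2 : ℝ≥0) (N_e : ℕ) (ν : Measure ℝ) (P : ℝ)
    {n : ℕ} (c : Code S.L n) : ℝ≥0∞ :=
  mutualInfo ((S.law σ2 N_e P c).prod (channelLaw M N_e n ν)) (fun ω => c.symbols ω.1.1)
    (fun ω => (S.received c ω.2 ω.1, ω.2)) / n

/-- Largest information rate, over all codes of length `n` and power `P`, given the channel
realization `g`. -/
def JammingScheme.maxRateGiven (S : JammingScheme M N_E) (σ2 : ℝ≥0) {N_e n : ℕ}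
    (g : Fin n → Channel M N_e) (P : ℝ) : ℝ≥0∞ :=
  ⨆ (c : Code S.L n) (_ : S.PowerConstraint P c), S.rateGiven σ2 P c g

/-- Largest information rate over all codes of power `P`, of any length, for the random
channel. -/
def JammingScheme.maxRate (S : JammingScheme M N_E) (σ2 : ℝ≥0) (N_e : ℕ) (ν : Measure ℝ) (P : ℝ) :
    ℝ≥0∞ :=
  ⨆ (n : ℕ) (_ : 0 < n) (c : Code S.L n) (_ : S.PowerConstraint P c), S.rate σ2 N_e ν P c

/-- Correlation matrix of the legitimate part of what the eavesdropper receives in use `k`. -/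
def JammingScheme.signalCov (S : JammingScheme M N_E) {N_e n : ℕ} (c : Code S.L n)
    (g : Fin n → Channel M N_e) (k : Fin n) : Matrix (Fin N_e) (Fin N_e) ℝ :=
  Matrix.of fun a b => ∫ w,
    (∑ i, (Matrix.of (g k i) * S.VL i).mulVec ((w i).2 k)) a *
    (∑ i, (Matrix.of (g k i) * S.VL i).mulVec ((w i).2 k)) b ∂c.sourceLaw

/-- Covariance matrix of the jamming part of what the eavesdropper receives in one channel use. -/
def JammingScheme.jamCov (S : JammingScheme M N_E) {N_e : ℕ} (P : ℝ) (h : Channel M N_e) :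
    Matrix (Fin N_e) (Fin N_e) ℝ :=
  ∑ i, S.jamPower P i • (Matrix.of (h i) * S.VJ i * (Matrix.of (h i) * S.VJ i).transpose)

/-- Half the logarithm of the ratio of the determinants of the covariance matrices of
signal plus jamming plus noise and of jamming plus noise, averaged over the block. -/
def JammingScheme.logDetBound (S : JammingScheme M N_E) (σ2 : ℝ≥0) {N_e n : ℕ} (P : ℝ)
    (c : Code S.L n) (g : Fin n → Channel M N_e) : ℝ :=
  (∑ k, (1 / 2) * Real.log
    (((σ2 : ℝ) • (1 : Matrix (Fin N_e) (Fin N_e) ℝ) + S.signalCov c g k + S.jamCov P (g k)).det /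
      ((σ2 : ℝ) • (1 : Matrix (Fin N_e) (Fin N_e) ℝ) + S.jamCov P (g k)).det)) / n

/-- With transmit power `P` and some code, the eavesdropper can decode a part of the pair of messages
of rate `R` (nats per channel use) with error probability at most `ε`, from the received block and
the channel block. The part is a function of the two messages (one of them, both, or a sub-message)
that is uniformly distributed on its `m` values. -/
def JammingScheme.Decodes (S : JammingScheme M N_E) (σ2 : ℝ≥0) (N_e : ℕ) (ν : Measure ℝ)
    (P ε R : ℝ) : Prop :=
  ∃ n : ℕ, 0 < n ∧ ∃ c : Code S.L n, S.PowerConstraint P c ∧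
  ∃ (m : ℕ) (part : ((i : Fin 2) → Fin (c.card i)) → Fin m)
    (φ : Block N_e n × (Fin n → Channel M N_e) → Fin m),
    (∀ b b', (part ⁻¹' {b}).ncard = (part ⁻¹' {b'}).ncard) ∧
    Measurable φ ∧
    ((S.law σ2 N_e P c).prod (channelLaw M N_e n ν))
      {ω | φ (S.received c ω.2 ω.1, ω.2) ≠ part (c.messages ω.1.1)} ≤ ENNReal.ofReal ε ∧
    R = Real.log m / n

end

end Wiretap

/-! The eavesdropper has no more antennas than there are jamming symbols, so for almost every
channel the jamming fills its whole received space. Signal and jamming then grow at the same rate in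
`P`, and their ratio stays bounded.

Upper bound by a log-determinant. For every law `Q`, the mutual information is at most the mean
divergence of the conditional output law from `Q` (`mutualInfo_le_lintegral_klDiv`). In each use a
linear map takes jamming plus noise to identity covariance and the signal to a diagonal
second-moment matrix `d` (`exists_whitening`). Given the source, the whitened output is a
unit-variance Gaussian vector; `Q` is the centred product Gaussian with variances `1 + d`. The mean
divergence is then exactly half the sum of `log (1 + d)`, which is half the log-determinant ratio,
whatever the symbol law (`mutualInfo_source_le`).

Bound independent of the power. A row `t` of the whitening matrix has quadratic form 1 under noise
plus jamming. If `D` is the determinant of `N_e` independent received jamming directions, this form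
is at least `P` times `D ^ 2` times the squared norm of `t`, up to a polynomial in the channel gain
(`exists_jamming_lower_bound`). The received signal power is at most the gain times the sent power,
so `P` cancels from `d` (`whitened_row_le`).

Nondegeneracy. Once the precoders are normalised, each diagonal entry of the chosen square matrix
can be changed by resampling a single channel entry. The determinant is affine in that entry with a
minor as slope. By induction it is almost surely nonzero when `ν` has no atoms, and its negative
logarithm has bounded mean when `ν` has a bounded density.

Random channel. As the channel is independent of the source, the bound may be averaged over it.
Without a bounded density the mean of the power-free bound can be infinite; the jamming-free bound,
of order `log P`, then serves as dominating function, and dominated convergence gives zero degrees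
of freedom (`tendsto_meanRateBound_div`). Fano's inequality, read as a lower bound for a divergence,
carries this over to decoded messages (`decodes_rate_le`). -/

namespace Wiretap

open InformationTheory

/-! ### Divergence, mutual information and Fano's inequality -/

section Divergence

variable {α β γ Ω : Type*} [MeasurableSpace α] [MeasurableSpace β] [MeasurableSpace γ]
  [MeasurableSpace Ω]

/-- Integral form of the conditional divergence, as an upper bound. -/
lemma klDiv_compProd_right_le_lintegral [MeasurableSpace.CountableOrCountablyGenerated α β]
    (μ : Measure α) [IsFiniteMeasure μ] (κ η : Kernel α β) [IsMarkovKernel κ] [IsMarkovKernel η]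
    (F : α → ℝ≥0∞) (hF : ∀ᵐ a ∂μ, F a ≠ ∞) (h : ∀ᵐ a ∂μ, klDiv (κ a) (η a) ≤ F a) :
    klDiv (μ ⊗ₘ κ) (μ ⊗ₘ η) ≤ ∫⁻ a, F a ∂μ := by
  have hac : ∀ᵐ a ∂μ, κ a ≪ η a := by
    filter_upwards [hF, h] with a h1 h2
    exact (klDiv_ne_top_iff.mp (ne_top_of_le_ne_top h1 h2)).1
  have hac' : μ ⊗ₘ κ ≪ μ ⊗ₘ η := Measure.AbsolutelyContinuous.compProd_right hac
  have hfin : IsFiniteKernel (η.withDensity (κ.rnDeriv η)) := inferInstance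
  have hr : Measurable fun p : α × β => κ.rnDeriv η p.1 p.2 := Kernel.measurable_rnDeriv κ η
  -- The kernel derivative is jointly measurable, so it is also the density of the joint laws; the
  -- divergence thus becomes an iterated integral.
  have heq : μ ⊗ₘ κ = (μ ⊗ₘ η).withDensity fun p => κ.rnDeriv η p.1 p.2 := by
    rw [← Measure.compProd_withDensity (Kernel.measurable_rnDeriv κ η)]
    refine Measure.compProd_congr ?_
    filter_upwards [hac] with a ha
    exact (Kernel.withDensity_rnDeriv_eq ha).symm
  have hrn : (μ ⊗ₘ κ).rnDeriv (μ ⊗ₘ η) =ᵐ[μ ⊗ₘ η] fun p => κ.rnDeriv η p.1 p.2 := by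
    conv_lhs => rw [heq]
    exact Measure.rnDeriv_withDensity _ hr
  rw [klDiv_eq_lintegral_klFun_of_ac hac']
  calc ∫⁻ p, ENNReal.ofReal (klFun (((μ ⊗ₘ κ).rnDeriv (μ ⊗ₘ η) p).toReal)) ∂(μ ⊗ₘ η)
      = ∫⁻ p, ENNReal.ofReal (klFun ((κ.rnDeriv η p.1 p.2).toReal)) ∂(μ ⊗ₘ η) := by
        refine lintegral_congr_ae ?_
        filter_upwards [hrn] with p hp
        rw [hp]
    _ = ∫⁻ a, ∫⁻ b, ENNReal.ofReal (klFun ((κ.rnDeriv η a b).toReal)) ∂(η a) ∂μ := by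
        rw [Measure.lintegral_compProd]
        exact (measurable_klFun.comp hr.ennreal_toReal).ennreal_ofReal
    _ ≤ ∫⁻ a, F a ∂μ := by
        refine lintegral_mono_ae ?_
        filter_upwards [hac, h] with a h1 h2
        refine le_trans (le_of_eq ?_) h2
        rw [klDiv_eq_lintegral_klFun_of_ac h1]
        refine lintegral_congr_ae ?_
        filter_upwards [Kernel.rnDeriv_eq_rnDeriv_measure (κ := κ) (η := η) (a := a)] with b hb
        rw [hb]

/-- The law of `f (a, ω)` for `ω` of law `ρ`, as a kernel in `a`. -/
noncomputable def imageKernel (ρ : Measure Ω) [IsProbabilityMeasure ρ] (f : α × Ω → β) :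
    Kernel α β :=
  (Kernel.id ×ₖ Kernel.const α ρ).map f

variable (ρ : Measure Ω) [IsProbabilityMeasure ρ] {f : α × Ω → β}

lemma imageKernel_apply (hf : Measurable f) (a : α) :
    imageKernel ρ f a = ρ.map fun ω => f (a, ω) := by
  rw [imageKernel, Kernel.map_apply _ hf, Kernel.prod_apply, Kernel.id_apply, Kernel.const_apply,
    Measure.dirac_prod, Measure.map_map hf (by fun_prop)]
  rfl

lemma isMarkovKernel_imageKernel (hf : Measurable f) : IsMarkovKernel (imageKernel ρ f) :=
  Kernel.IsMarkovKernel.map _ hf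

lemma compProd_imageKernel (μ : Measure α) [SFinite μ] (hf : Measurable f) :
    μ ⊗ₘ imageKernel ρ f = (μ.prod ρ).map fun p => (p.1, f p) := by
  have := isMarkovKernel_imageKernel ρ hf
  ext s hs
  rw [Measure.compProd_apply hs, Measure.map_apply (by fun_prop) hs,
    Measure.prod_apply (measurable_fst.prodMk hf hs)]
  refine lintegral_congr fun a => ?_
  rw [imageKernel_apply ρ hf, Measure.map_apply (by fun_prop) (measurable_prodMk_left hs)]
  rfl

/-- Data processing for the mutual information. -/
lemma mutualInfo_comp_le (μ : Measure Ω) [IsFiniteMeasure μ] {X : Ω → α} {Y : Ω → β}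
    (hX : Measurable X) (hY : Measurable Y) {g : α → γ} (hg : Measurable g) :
    mutualInfo μ (fun ω => g (X ω)) Y ≤ mutualInfo μ X Y := by
  have h := klDiv_map_le (μ.map fun ω => (X ω, Y ω)) ((μ.map X).prod (μ.map Y))
    (g := Prod.map g id) (by fun_prop)
  rw [Measure.map_map (by fun_prop) (by fun_prop),
    ← Measure.map_prod_map _ _ hg measurable_id, Measure.map_map hg hX, Measure.map_id] at h
  exact h

/-- Data processing for the mutual information, when the second variable can be recovered from its
image. -/
lemma mutualInfo_le_of_leftInverse (μ : Measure Ω) [IsFiniteMeasure μ] {X : Ω → α} {Y : Ω → β}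
    (hX : Measurable X) (hY : Measurable Y) {g : β → γ} (hg : Measurable g) {k : γ → β}
    (hk : Measurable k) (hkg : ∀ y, k (g y) = y) :
    mutualInfo μ X Y ≤ mutualInfo μ X (fun ω => g (Y ω)) := by
  have h := klDiv_map_le (μ.map fun ω => (X ω, g (Y ω))) ((μ.map X).prod (μ.map fun ω => g (Y ω)))
    (g := Prod.map id k) (by fun_prop)
  rw [Measure.map_map (by fun_prop) (by fun_prop),
    ← Measure.map_prod_map _ _ measurable_id hk, Measure.map_map hk (by fun_prop),
    Measure.map_id] at h
  simpa [mutualInfo, Function.comp_def, hkg] using h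

/-- The mutual information is at most the mean divergence of the conditional law of the output from
any fixed law. -/
lemma mutualInfo_le_lintegral_klDiv [StandardBorelSpace α] [Nonempty α]
    [MeasurableSpace.CountableOrCountablyGenerated α β]
    (μ : Measure α) [IsProbabilityMeasure μ] (hf : Measurable f)
    (Q : Measure β) [IsProbabilityMeasure Q] (F : α → ℝ≥0∞) (hF : ∀ a, F a ≠ ∞)
    (h : ∀ a, klDiv (ρ.map fun ω => f (a, ω)) Q ≤ F a) :
    mutualInfo (μ.prod ρ) Prod.fst f ≤ ∫⁻ a, F a ∂μ := by
  have := isMarkovKernel_imageKernel ρ hf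
  set joint : Measure (α × β) := (μ.prod ρ).map fun p => (p.1, f p) with hjoint
  have hjp : IsProbabilityMeasure joint :=
    Measure.isProbabilityMeasure_map (by fun_prop)
  have hswap : IsProbabilityMeasure (joint.map Prod.swap) :=
    Measure.isProbabilityMeasure_map (by fun_prop)
  have hYp : IsProbabilityMeasure ((μ.prod ρ).map f) :=
    Measure.isProbabilityMeasure_map hf.aemeasurable
  have hfst : (joint.map Prod.swap).fst = (μ.prod ρ).map f := by
    rw [Measure.fst, Measure.map_map (by fun_prop) (by fun_prop), hjoint,
      Measure.map_map (by fun_prop) (by fun_prop)]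
    rfl
  have hdis : (μ.prod ρ).map f ⊗ₘ (joint.map Prod.swap).condKernel = joint.map Prod.swap := by
    rw [← hfst]
    exact Measure.disintegrate _ _
  have hX : (μ.prod ρ).map Prod.fst = μ := by
    rw [← Measure.fst, Measure.fst_prod]
  calc mutualInfo (μ.prod ρ) Prod.fst f
      = klDiv ((joint.map Prod.swap).map Prod.swap)
          ((((μ.prod ρ).map f).prod μ).map Prod.swap) := by
        rw [mutualInfo, hX, Measure.prod_swap, Measure.map_map (by fun_prop) (by fun_prop)]
        simp [hjoint]
    _ ≤ klDiv (joint.map Prod.swap) (((μ.prod ρ).map f).prod μ) :=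
        klDiv_map_le _ _ measurable_swap
    -- The discarded gap is the divergence of the true output law from `Q`. The chain rule, applied
    -- with the output as first coordinate and the conditional law of the input given it, merges the
    -- two terms into one divergence from a product with `Q`.
    _ ≤ klDiv ((μ.prod ρ).map f) Q + klDiv (joint.map Prod.swap) (((μ.prod ρ).map f).prod μ) :=
        le_add_self
    _ = klDiv (joint.map Prod.swap) (Q.prod μ) := by
        have := klDiv_compProd_eq_add ((μ.prod ρ).map f) Q (joint.map Prod.swap).condKernel
          (Kernel.const β μ)
        rw [hdis, Measure.compProd_const, Measure.compProd_const] at this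
        exact this.symm
    _ = klDiv (joint.map Prod.swap) ((μ.prod Q).map Prod.swap) := by
        rw [Measure.prod_swap]
    _ ≤ klDiv joint (μ.prod Q) := klDiv_map_le _ _ measurable_swap
    _ = klDiv (μ ⊗ₘ imageKernel ρ f) (μ ⊗ₘ Kernel.const α Q) := by
        rw [compProd_imageKernel ρ μ hf, Measure.compProd_const]
    _ ≤ ∫⁻ a, F a ∂μ := by
        refine klDiv_compProd_right_le_lintegral _ _ _ F (.of_forall hF) (.of_forall fun a => ?_)
        rw [imageKernel_apply ρ hf]
        exact h a

/-- If the output is observed together with an independent state, then the mutual information is at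
most the mean of the mutual information given the state. -/
lemma mutualInfo_prodMk_le_lintegral {G : Type*} [MeasurableSpace G]
    [MeasurableSpace.CountableOrCountablyGenerated G (α × β)]
    (τ : Measure G) [IsProbabilityMeasure τ] {X : Ω → α} (hX : Measurable X)
    {f : Ω → G → β} (hf : Measurable (Function.uncurry f)) (F : G → ℝ≥0∞)
    (hF : ∀ᵐ g ∂τ, F g ≠ ∞)
    (h : ∀ᵐ g ∂τ, mutualInfo ρ X (fun ω => f ω g) ≤ F g) :
    mutualInfo (ρ.prod τ) (fun ω => X ω.1) (fun ω => (f ω.1 ω.2, ω.2)) ≤ ∫⁻ g, F g ∂τ := by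
  have hf' : Measurable fun p : G × Ω => f p.2 p.1 := hf.comp measurable_swap
  have hXp : IsProbabilityMeasure (ρ.map X) := Measure.isProbabilityMeasure_map hX.aemeasurable
  have hm1 : Measurable fun p : G × Ω => (X p.2, f p.2 p.1) := by fun_prop
  have hm2 : Measurable fun p : G × (α × Ω) => (p.2.1, f p.2.2 p.1) :=
    measurable_snd.fst.prodMk (hf'.comp (measurable_fst.prodMk measurable_snd.snd))
  have := isMarkovKernel_imageKernel ρ hm1
  have := isMarkovKernel_imageKernel ((ρ.map X).prod ρ) hm2
  -- With the state as first coordinate, both laws share the marginal `τ`. Given the state, the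
  -- second kernel is the product of the law of `X` and the law of the output.
  have key := klDiv_map_le (τ ⊗ₘ imageKernel ρ fun p : G × Ω => (X p.2, f p.2 p.1))
    (τ ⊗ₘ imageKernel ((ρ.map X).prod ρ) fun p : G × (α × Ω) => (p.2.1, f p.2.2 p.1))
    (g := fun q : G × (α × β) => (q.2.1, (q.2.2, q.1))) (by fun_prop)
  have h1 : (τ ⊗ₘ imageKernel ρ fun p : G × Ω => (X p.2, f p.2 p.1)).map
      (fun q : G × (α × β) => (q.2.1, (q.2.2, q.1))) =
      (ρ.prod τ).map fun ω => (X ω.1, (f ω.1 ω.2, ω.2)) := by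
    rw [compProd_imageKernel ρ τ hm1, Measure.map_map (by fun_prop) (by fun_prop),
      ← Measure.prod_swap, Measure.map_map (by fun_prop) (by fun_prop)]
    rfl
  -- Here the independence of `X` and the state enters: averaging the conditional products over the
  -- state again gives a product law.
  have h2 : (τ ⊗ₘ imageKernel ((ρ.map X).prod ρ) fun p : G × (α × Ω) => (p.2.1, f p.2.2 p.1)).map
      (fun q : G × (α × β) => (q.2.1, (q.2.2, q.1))) =
      ((ρ.prod τ).map fun ω => X ω.1).prod ((ρ.prod τ).map fun ω => (f ω.1 ω.2, ω.2)) := by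
    have e1 : (ρ.prod τ).map (fun ω => X ω.1) = ρ.map X := by
      have : (ρ.prod τ).map (X ∘ Prod.fst) = ρ.map X := by
        rw [← Measure.map_map hX measurable_fst, ← Measure.fst, Measure.fst_prod]
      exact this
    have hm3 : Measurable fun ω : Ω × G => (f ω.1 ω.2, ω.2) := hf.prodMk measurable_snd
    have hm4 : Measurable fun q : G × (α × Ω) => (q.2.1, (f q.2.2 q.1, q.1)) :=
      measurable_snd.fst.prodMk ((hf'.comp (measurable_fst.prodMk measurable_snd.snd)).prodMk
        measurable_fst)
    rw [e1, compProd_imageKernel _ τ hm2, Measure.map_map (by fun_prop) (by fun_prop)]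
    conv_rhs => rw [← Measure.map_id (μ := ρ.map X)]
    rw [Measure.map_prod_map _ _ measurable_id hm3, ← Measure.prod_swap,
      ← (measurePreserving_prodAssoc (ρ.map X) ρ τ).map_eq,
      Measure.map_map (by fun_prop) (by fun_prop), Measure.map_map (by fun_prop) (by fun_prop)]
    rfl
  rw [h1, h2] at key
  refine key.trans (klDiv_compProd_right_le_lintegral _ _ _ F hF ?_)
  filter_upwards [h] with g hg
  rw [imageKernel_apply _ hm1, imageKernel_apply _ hm2]
  have hfg : Measurable fun ω => f ω g := by fun_prop
  have := Measure.map_prod_map (ρ.map X) ρ measurable_id hfg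
  rw [Measure.map_id] at this
  refine le_trans (le_of_eq ?_) hg
  rw [mutualInfo, this]
  rfl

/-- Chain rule for constant kernels. An infinite second term is split off because the integral bound
asks for a finite majorant. -/
lemma klDiv_prod_le [MeasurableSpace.CountableOrCountablyGenerated α β]
    (μ₁ ν₁ : Measure α) (μ₂ ν₂ : Measure β) [IsProbabilityMeasure μ₁] [IsProbabilityMeasure ν₁]
    [IsProbabilityMeasure μ₂] [IsProbabilityMeasure ν₂] :
    klDiv (μ₁.prod μ₂) (ν₁.prod ν₂) ≤ klDiv μ₁ ν₁ + klDiv μ₂ ν₂ := by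
  rcases eq_or_ne (klDiv μ₂ ν₂) ∞ with h | h
  · simp [h]
  rw [← Measure.compProd_const, ← Measure.compProd_const, klDiv_compProd_eq_add]
  gcongr
  refine (klDiv_compProd_right_le_lintegral _ _ _ (fun _ => klDiv μ₂ ν₂) (.of_forall fun _ => h)
    (.of_forall fun _ => ?_)).trans (by simp)
  simp

lemma klDiv_pi_le [StandardBorelSpace β] {n : ℕ} (μ ν : Fin n → Measure β)
    [∀ i, IsProbabilityMeasure (μ i)] [∀ i, IsProbabilityMeasure (ν i)] :
    klDiv (Measure.pi μ) (Measure.pi ν) ≤ ∑ i, klDiv (μ i) (ν i) := by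
  induction n with
  | zero => simp [Subsingleton.elim μ ν]
  | succ n ih =>
    have e (τ : Fin (n + 1) → Measure β) [∀ i, IsProbabilityMeasure (τ i)] :=
      ((measurePreserving_piFinSuccAbove τ 0).symm _).map_eq
    rw [← e μ, ← e ν, Fin.sum_univ_succ]
    exact (klDiv_map_le _ _ (MeasurableEquiv.measurable _)).trans
      ((klDiv_prod_le _ _ _ _).trans (add_le_add le_rfl (ih _ _)))

/-- Fenchel-Young inequality for the convex function `klFun`; it is `y + 1 ≤ exp y` at `y = a - log
x`, multiplied by `x`. -/
lemma mul_sub_exp_add_one_le_klFun {x : ℝ} (hx : 0 ≤ x) (a : ℝ) :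
    a * x - Real.exp a + 1 ≤ klFun x := by
  rcases hx.eq_or_lt with rfl | hx
  · simp [klFun_zero, (Real.exp_pos a).le]
  have h1 := Real.add_one_le_exp (a - Real.log x)
  rw [Real.exp_sub, Real.exp_log hx, le_div_iff₀ hx] at h1
  rw [klFun]
  nlinarith

/-- **Fano's inequality**, for an event whose probability under the second measure is that of a
uniform guess among `m`. -/
lemma measureReal_mul_log_sub_log_two_le_klDiv (μ ν : Measure α) [IsProbabilityMeasure μ]
    [IsProbabilityMeasure ν] (h : klDiv μ ν ≠ ∞) {E : Set α} (hE : MeasurableSet E) {m : ℕ}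
    (hm : 0 < m) (hν : ν.real E ≤ 1 / m) :
    μ.real E * Real.log m - Real.log 2 ≤ (klDiv μ ν).toReal := by
  obtain ⟨hac, hint⟩ := klDiv_ne_top_iff.mp h
  have hm0 : (0 : ℝ) < m := by exact_mod_cast hm
  set r := fun x => (μ.rnDeriv ν x).toReal with hr
  have hr_int : Integrable r ν := Measure.integrable_toReal_rnDeriv
  have hrE : ∫ x, E.indicator r x ∂ν = μ.real E := by
    rw [integral_indicator hE, Measure.setIntegral_toReal_rnDeriv hac]
  have hr1 : ∫ x, r x ∂ν = 1 := by
    rw [Measure.integral_toReal_rnDeriv hac]; simp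
  have hEi : Integrable (E.indicator fun _ => (1 : ℝ)) ν := (integrable_const _).indicator hE
  have hEν : ∫ x, E.indicator (fun _ => (1 : ℝ)) x ∂ν = ν.real E := by
    rw [integral_indicator_const _ hE]; simp
  -- Fenchel-Young with slope `log (m / 2)` on `E` and `log (1 / 2)` off `E`. The exponentials `m /
  -- 2` and `1 / 2` then integrate to at most 1 under `ν`, since `ν` gives `E` mass at most `1 / m`.
  have hle : ∀ x, Real.log m * E.indicator r x - Real.log 2 * r x
      - ((m - 1) / 2 * E.indicator (fun _ => (1 : ℝ)) x + 1 / 2) + 1 ≤ klFun (r x) := by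
    intro x
    have hx : 0 ≤ r x := ENNReal.toReal_nonneg
    by_cases hxE : x ∈ E
    · have := mul_sub_exp_add_one_le_klFun hx (Real.log m - Real.log 2)
      rw [Real.exp_sub, Real.exp_log hm0, Real.exp_log two_pos] at this
      simp only [hxE, Set.indicator_of_mem]
      linarith
    · have := mul_sub_exp_add_one_le_klFun hx (-Real.log 2)
      rw [Real.exp_neg, Real.exp_log two_pos] at this
      simp only [hxE, Set.indicator_of_notMem, not_false_eq_true]
      linarith
  have hi1 : Integrable (fun x => Real.log m * E.indicator r x) ν :=
    (hr_int.indicator hE).const_mul _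
  have hi2 : Integrable (fun x => Real.log 2 * r x) ν := hr_int.const_mul _
  have hi3 : Integrable (fun x => (m - 1) / 2 * E.indicator (fun _ => (1 : ℝ)) x) ν :=
    hEi.const_mul _
  have hi4 := hi3.add (integrable_const (μ := ν) (1 / 2 : ℝ))
  rw [toReal_klDiv_eq_integral_klFun hac]
  have hmono : ∫ x, (Real.log m * E.indicator r x - Real.log 2 * r x
      - ((m - 1) / 2 * E.indicator (fun _ => (1 : ℝ)) x + 1 / 2) + 1) ∂ν ≤ _ := integral_mono (((hi1.sub hi2).sub hi4).add (integrable_const (1 : ℝ)))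
    ((integrable_klFun_rnDeriv_iff hac).mpr hint) hle
  refine le_trans ?_ hmono
  have hcalc : ∫ x, (Real.log m * E.indicator r x - Real.log 2 * r x
      - ((m - 1) / 2 * E.indicator (fun _ => (1 : ℝ)) x + 1 / 2) + 1) ∂ν =
      Real.log m * μ.real E - Real.log 2 - ((m - 1) / 2 * ν.real E + 1 / 2) + 1 := by
    have e1 := integral_add ((hi1.sub hi2).sub hi4) (integrable_const (1 : ℝ))
    have e2 := integral_sub (hi1.sub hi2) hi4
    have e3 := integral_sub hi1 hi2
    have e4 := integral_add hi3 (integrable_const (μ := ν) (1 / 2 : ℝ))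
    simp only [Pi.add_apply, Pi.sub_apply, integral_const_mul, hrE, hr1, hEν, integral_const,
      probReal_univ, smul_eq_mul, mul_one, one_mul] at e1 e2 e3 e4
    rw [e1, e2, e3, e4]
  refine le_trans ?_ hcalc.ge
  have h1 : (m - 1 : ℝ) / 2 * ν.real E ≤ (m - 1) / 2 * (1 / m) := by
    have : (1 : ℝ) ≤ m := by exact_mod_cast hm
    gcongr
  have h2 : (m - 1 : ℝ) / 2 * (1 / m) = 1 / 2 - 1 / (2 * m) := by field_simp
  have h3 : 0 < 1 / (2 * m : ℝ) := by positivity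
  linarith

end Divergence

/-! ### Divergence of Gaussian laws on the line -/

section GaussianDivergence

lemma klDiv_withDensity_exp {α : Type*} [MeasurableSpace α] (μ ν : Measure α)
    [IsProbabilityMeasure μ] [IsProbabilityMeasure ν] {g : α → ℝ} (hg : Measurable g)
    (h : μ = ν.withDensity fun x => ENNReal.ofReal (Real.exp (g x))) (hi : Integrable g μ) :
    klDiv μ ν = ENNReal.ofReal (∫ x, g x ∂μ) := by
  have hac : μ ≪ ν := h ▸ withDensity_absolutelyContinuous _ _
  have hllr : llr μ ν =ᵐ[μ] g := by
    have : μ.rnDeriv ν =ᵐ[ν] fun x => ENNReal.ofReal (Real.exp (g x)) := by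
      conv_lhs => rw [h]
      exact Measure.rnDeriv_withDensity _ (by fun_prop)
    filter_upwards [hac this] with x hx
    rw [llr, hx, ENNReal.toReal_ofReal (Real.exp_pos _).le, Real.log_exp]
  rw [klDiv_of_ac_of_integrable hac ((integrable_congr hllr).mpr hi), integral_congr_ae hllr]
  simp

lemma klDiv_gaussianReal (m : ℝ) {v : ℝ≥0} (hv : v ≠ 0) :
    klDiv (gaussianReal m 1) (gaussianReal 0 v) =
      ENNReal.ofReal (1 / 2 * (Real.log v + (1 + m ^ 2) / v - 1)) := by
  have hv' : (0 : ℝ) < v := by positivity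
  have h2 : MemLp id 2 (gaussianReal m 1) := memLp_id_gaussianReal' 2 (by simp)
  have hid : Integrable (fun x : ℝ => x) (gaussianReal m 1) := h2.integrable (by simp)
  have hsq : Integrable (fun x : ℝ => (x - m) ^ 2) (gaussianReal m 1) :=
    (h2.sub (memLp_const m)).integrable_sq
  have hvar : ∫ x, (x - m) ^ 2 ∂(gaussianReal m 1) = 1 := by
    have h := variance_fun_id_gaussianReal (μ := m) (v := 1)
    rw [variance_eq_integral (by fun_prop)] at h
    simpa using h
  -- The log-likelihood ratio, expanded around `m` so that its mean needs only the mean and the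
  -- variance of the first law.
  set g : ℝ → ℝ := fun x => 1 / 2 * Real.log v + (-(1 / 2) + 1 / (2 * v)) * (x - m) ^ 2
    + (m / v * x - m ^ 2 / (2 * v)) with hgdef
  have hi1 : Integrable (fun x => (-(1 / 2) + 1 / (2 * v)) * (x - m) ^ 2) (gaussianReal m 1) :=
    hsq.const_mul _
  have hi2 : Integrable (fun x => m / v * x) (gaussianReal m 1) := hid.const_mul _
  have hi3 : Integrable (fun x => 1 / 2 * Real.log v + (-(1 / 2) + 1 / (2 * v)) * (x - m) ^ 2)
    (gaussianReal m 1) := (integrable_const _).add hi1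
  have hi4 : Integrable (fun x => m / v * x - m ^ 2 / (2 * v)) (gaussianReal m 1) :=
    hi2.sub (integrable_const _)
  have hint : ∫ x, g x ∂(gaussianReal m 1) = 1 / 2 * (Real.log v + (1 + m ^ 2) / v - 1) := by
    rw [hgdef, integral_add hi3 hi4, integral_add (integrable_const _) hi1,
      integral_sub hi2 (integrable_const _), integral_const_mul (-(1 / 2) + 1 / (2 * (v : ℝ))),
      integral_const_mul (m / (v : ℝ)), hvar, integral_id_gaussianReal]
    simp only [integral_const, probReal_univ, smul_eq_mul]
    field_simp
    ring
  rw [← hint]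
  refine klDiv_withDensity_exp _ _ (by fun_prop) ?_ (hi3.add hi4)
  rw [gaussianReal_of_var_ne_zero _ one_ne_zero, gaussianReal_of_var_ne_zero _ hv,
    ← withDensity_mul _ (measurable_gaussianPDF _ _) (by fun_prop)]
  congr 1
  ext x
  rw [Pi.mul_apply, gaussianPDF, gaussianPDF, ← ENNReal.ofReal_mul (gaussianPDFReal_nonneg _ _ _)]
  congr 1
  have hs : (√(2 * Real.pi * v))⁻¹ =
      (√(2 * Real.pi * (1 : ℝ≥0)))⁻¹ * Real.exp (-(1 / 2 * Real.log v)) := by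
    rw [Real.sqrt_mul (by positivity) (v : ℝ), mul_inv, Real.exp_neg, NNReal.coe_one, mul_one,
      mul_comm (1 / 2 : ℝ), Real.exp_mul, Real.exp_log hv', ← Real.sqrt_eq_rpow]
  have hexp : -(x - m) ^ 2 / (2 * ((1 : ℝ≥0) : ℝ)) =
      -(1 / 2 * Real.log v) + -(x - 0) ^ 2 / (2 * v) + g x := by
    simp only [hgdef, NNReal.coe_one]
    field_simp
    ring
  rw [gaussianPDFReal, gaussianPDFReal, hs, hexp, Real.exp_add, Real.exp_add]
  ring

end GaussianDivergence

end Wiretap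

namespace Wiretap

/-! ### Whitening and quantitative invertibility of matrices -/

section MatrixBounds

open Matrix

variable {m n : Type*} [Fintype m] [Fintype n]

lemma exists_orthogonal_diagonalization [DecidableEq n] {A : Matrix n n ℝ} (hA : A.IsHermitian) :
    ∃ U : Matrix n n ℝ, Uᵀ * U = 1 ∧ Uᵀ * A * U = diagonal hA.eigenvalues := by
  refine ⟨hA.eigenvectorUnitary.1, ?_, ?_⟩
  · have := Unitary.coe_star_mul_self hA.eigenvectorUnitary
    rwa [star_eq_conjTranspose, conjTranspose_eq_transpose_of_trivial] at this
  · have h1 := Unitary.coe_star_mul_self hA.eigenvectorUnitary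
    rw [star_eq_conjTranspose, conjTranspose_eq_transpose_of_trivial] at h1
    have h2 := hA.spectral_theorem
    rw [Unitary.conjStarAlgAut_apply, star_eq_conjTranspose,
      conjTranspose_eq_transpose_of_trivial] at h2
    set U : Matrix n n ℝ := hA.eigenvectorUnitary.1
    calc Uᵀ * A * U = Uᵀ * (U * diagonal (RCLike.ofReal ∘ hA.eigenvalues) * Uᵀ) * U := by rw [← h2]
      _ = (Uᵀ * U) * diagonal (RCLike.ofReal ∘ hA.eigenvalues) * (Uᵀ * U) := by
        simp only [Matrix.mul_assoc]
      _ = diagonal hA.eigenvalues := by rw [h1]; simp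

/-- Simultaneous diagonalization of a positive definite and a positive semidefinite matrix. -/
lemma exists_whitening [DecidableEq n] {K S : Matrix n n ℝ} (hK : K.PosDef) (hS : S.PosSemidef) :
    ∃ T : Matrix n n ℝ, ∃ d : n → ℝ, (∀ a, 0 ≤ d a) ∧ T * K * Tᵀ = 1 ∧ T * S * Tᵀ = diagonal d := by
  obtain ⟨U, hU, hUK⟩ := exists_orthogonal_diagonalization hK.isHermitian
  set l := hK.isHermitian.eigenvalues with hl
  have hpos : ∀ a, 0 < l a := hK.eigenvalues_pos
  set T₀ : Matrix n n ℝ := diagonal (fun a => (√(l a))⁻¹) * Uᵀ with hT₀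
  have hT₀K : T₀ * K * T₀ᵀ = 1 := by
    calc T₀ * K * T₀ᵀ = diagonal (fun a => (√(l a))⁻¹) * (Uᵀ * K * U) *
          diagonal (fun a => (√(l a))⁻¹) := by
          rw [hT₀, transpose_mul, transpose_transpose, diagonal_transpose]
          simp only [Matrix.mul_assoc]
      _ = 1 := by
          rw [hUK, diagonal_mul_diagonal, diagonal_mul_diagonal, ← diagonal_one]
          congr 1
          ext a
          have h1 : √(l a) ≠ 0 := (Real.sqrt_pos.mpr (hpos a)).ne'
          have h2 := Real.mul_self_sqrt (hpos a).le
          field_simp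
          nlinarith
  have hS' : (T₀ * S * T₀ᵀ).PosSemidef := by
    have := hS.mul_mul_conjTranspose_same T₀
    rwa [conjTranspose_eq_transpose_of_trivial] at this
  obtain ⟨V, hV, hVS⟩ := exists_orthogonal_diagonalization hS'.isHermitian
  refine ⟨Vᵀ * T₀, _, hS'.eigenvalues_nonneg, ?_, ?_⟩
  · calc Vᵀ * T₀ * K * (Vᵀ * T₀)ᵀ = Vᵀ * (T₀ * K * T₀ᵀ) * V := by
          rw [transpose_mul, transpose_transpose]; simp only [Matrix.mul_assoc]
      _ = 1 := by rw [hT₀K, Matrix.mul_one, hV]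
  · rw [← hVS, transpose_mul, transpose_transpose]; simp only [Matrix.mul_assoc]

/-- The factor `T.det ^ 2` is common to both determinants and cancels; `T * K * Tᵀ = 1` makes
`K.det` nonzero. -/
lemma det_add_div_det [DecidableEq n] {K S T : Matrix n n ℝ} {d : n → ℝ} (hTK : T * K * Tᵀ = 1)
    (hTS : T * S * Tᵀ = diagonal d) : (K + S).det / K.det = ∏ a, (1 + d a) := by
  have h1 : T.det * K.det * T.det = 1 := by
    have := congr_arg det hTK
    rwa [det_mul, det_mul, det_transpose, det_one] at this
  have h2 : T.det * (K + S).det * T.det = ∏ a, (1 + d a) := by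
    have : T * (K + S) * Tᵀ = diagonal fun a => 1 + d a := by
      rw [Matrix.mul_add, Matrix.add_mul, hTK, hTS, ← diagonal_one, diagonal_add]
    have := congr_arg det this
    rwa [det_mul, det_mul, det_transpose, det_diagonal] at this
  have hK : K.det ≠ 0 := fun h => by simp [h] at h1
  rw [← h2, div_eq_iff hK]
  linear_combination (-(K + S).det) * h1

lemma sum_sq_mulVec_le (A : Matrix m n ℝ) (x : n → ℝ) :
    ∑ a, (A *ᵥ x) a ^ 2 ≤ (∑ a, ∑ b, A a b ^ 2) * ∑ b, x b ^ 2 := by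
  rw [Finset.sum_mul]
  exact Finset.sum_le_sum fun a _ => Finset.sum_mul_sq_le_sq_mul_sq _ _ _

/-- An entry of the adjugate is the determinant of the matrix with one row replaced by a unit
vector. The hypothesis `1 ≤ w` lets `w` bound that row too, and the Leibniz expansion has `n!`
terms. -/
lemma sum_sq_adjugate_le [DecidableEq n] (A : Matrix n n ℝ) {w : ℝ} (hw : 1 ≤ w)
    (hA : ∀ a b, |A a b| ≤ w) :
    ∑ a, ∑ b, A.adjugate a b ^ 2 ≤
      (Fintype.card n : ℝ) ^ 2 * ((Fintype.card n).factorial * w ^ Fintype.card n) ^ 2 := by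
  have h : ∀ a b, A.adjugate a b ^ 2 ≤ ((Fintype.card n).factorial * w ^ Fintype.card n) ^ 2 := by
    intro a b
    rw [← sq_abs, adjugate_apply]
    gcongr
    have := det_le (A := A.updateRow b (Pi.single a 1)) (abv := AbsoluteValue.abs) (x := w) ?_
    · simpa [nsmul_eq_mul] using this
    · intro i j
      simp only [AbsoluteValue.abs_apply, updateRow_apply]
      split_ifs
      · by_cases hj : j = a
        · subst hj; simpa using hw
        · simp only [Pi.single_apply, hj, if_false, abs_zero]; linarith
      · exact hA i j
  calc ∑ a, ∑ b, A.adjugate a b ^ 2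
      ≤ ∑ _a : n, ∑ _b : n, ((Fintype.card n).factorial * w ^ Fintype.card n) ^ 2 :=
        Finset.sum_le_sum fun a _ => Finset.sum_le_sum fun b _ => h a b
    _ = _ := by simp only [Finset.sum_const, Finset.card_univ, nsmul_eq_mul]; ring

/-- The adjugate recovers `det A • x` from `A *ᵥ x`. This lower bound on `A *ᵥ x` involves no
inverse and is polynomial in the entries except for the determinant. -/
lemma det_sq_mul_sum_sq_le [DecidableEq n] (A : Matrix n n ℝ) {w : ℝ} (hw : 1 ≤ w)
    (hA : ∀ a b, |A a b| ≤ w) (x : n → ℝ) :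
    A.det ^ 2 * ∑ a, x a ^ 2 ≤
      (Fintype.card n : ℝ) ^ 2 * ((Fintype.card n).factorial * w ^ Fintype.card n) ^ 2 *
        ∑ a, (A *ᵥ x) a ^ 2 := by
  have h : A.adjugate *ᵥ (A *ᵥ x) = A.det • x := by
    rw [mulVec_mulVec, adjugate_mul, smul_mulVec, one_mulVec]
  calc A.det ^ 2 * ∑ a, x a ^ 2 = ∑ a, (A.adjugate *ᵥ (A *ᵥ x)) a ^ 2 := by
        rw [h, Finset.mul_sum]; simp [mul_pow]
    _ ≤ _ := (sum_sq_mulVec_le _ _).trans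
        (mul_le_mul_of_nonneg_right (sum_sq_adjugate_le A hw hA) (by positivity))

/-- A matrix with linearly independent columns has an invertible square submatrix of full width. -/
lemma exists_submatrix_det_ne_zero {p q : ℕ} {V : Matrix (Fin p) (Fin q) ℝ}
    (hV : LinearIndependent ℝ V.col) : ∃ r : Fin q → Fin p, (V.submatrix r id).det ≠ 0 := by
  obtain ⟨κ, a, ha, hspan, hli⟩ := exists_linearIndependent' ℝ V.row
  have : Finite κ := Finite.of_injective a ha
  have : Fintype κ := Fintype.ofFinite κ
  have hcard : Fintype.card κ = q := by
    rw [← finrank_span_eq_card hli, hspan, ← rank_eq_finrank_span_row, ← rank_transpose]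
    simpa using LinearIndependent.rank_matrix (M := Vᵀ) hV
  let e : Fin q ≃ κ := (Fintype.equivFinOfCardEq hcard).symm
  refine ⟨a ∘ e, ?_⟩
  have hli' : LinearIndependent ℝ (V.submatrix (a ∘ e) id).row := hli.comp e e.injective
  exact ((isUnit_iff_isUnit_det _).mp (linearIndependent_rows_iff_isUnit.mp hli')).ne_zero

end MatrixBounds

end Wiretap

namespace Wiretap

/-! ### Random determinants under resampling of diagonal entries -/

section RandomDeterminant

/-- `Real.log` is `log |t|`, and `ENNReal.ofReal` cuts off negative values, so only `[-1, 1]`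
contributes; there the logarithm is integrable. -/
lemma lintegral_neg_log_lt_top : ∫⁻ t : ℝ, ENNReal.ofReal (-Real.log t) < ∞ := by
  have hi : IntegrableOn Real.log (Set.Icc (-1) 1) :=
    (integrableOn_Icc_iff_integrableOn_Ioc).mpr
      ((intervalIntegrable_iff_integrableOn_Ioc_of_le (by norm_num)).mp
        intervalIntegral.intervalIntegrable_log')
  rw [← setLIntegral_eq_of_support_subset (s := Set.Icc (-1) 1)]
  · exact hi.neg.lintegral_lt_top
  · intro t ht
    by_contra h
    refine ht (ENNReal.ofReal_of_nonpos ?_)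
    have h1 : 1 ≤ |t| := by
      by_contra h1
      exact h (abs_le.mp (not_le.mp h1).le)
    rw [← Real.log_abs]
    linarith [Real.log_nonneg h1]

/-- The mean of the negative part of the logarithm of an affine function of a variable with a
bounded density. -/
lemma lintegral_neg_log_affine_le {ν : Measure ℝ} {K : ℝ≥0} (hK : ν ≤ K • volume)
    [IsProbabilityMeasure ν] {q : ℝ} (hq : q ≠ 0) (r : ℝ) :
    ∫⁻ t, ENNReal.ofReal (-Real.log (r + t * q)) ∂ν ≤
      ENNReal.ofReal (-Real.log q) + K * ∫⁻ t : ℝ, ENNReal.ofReal (-Real.log t) := by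
  have hpt : ∀ t, ENNReal.ofReal (-Real.log (r + t * q)) ≤
      ENNReal.ofReal (-Real.log q) + ENNReal.ofReal (-Real.log (t + r / q)) := by
    intro t
    rcases eq_or_ne (r + t * q) 0 with h | h
    · simp [h]
    have h' : r + t * q = q * (t + r / q) := by field_simp; ring
    have h0 : t + r / q ≠ 0 := fun h0 => h (by rw [h', h0, mul_zero])
    rw [h', Real.log_mul hq h0, neg_add]
    exact ENNReal.ofReal_add_le
  calc ∫⁻ t, ENNReal.ofReal (-Real.log (r + t * q)) ∂ν
      ≤ ∫⁻ t, (ENNReal.ofReal (-Real.log q) + ENNReal.ofReal (-Real.log (t + r / q))) ∂ν :=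
        lintegral_mono hpt
    _ = ENNReal.ofReal (-Real.log q) + ∫⁻ t, ENNReal.ofReal (-Real.log (t + r / q)) ∂ν := by
        rw [lintegral_add_left measurable_const]; simp
    _ ≤ ENNReal.ofReal (-Real.log q) +
          ∫⁻ t, ENNReal.ofReal (-Real.log (t + r / q)) ∂(K • volume : Measure ℝ) := by
        gcongr
    _ = _ := by
        rw [lintegral_smul_measure,
          lintegral_add_right_eq_self (fun t : ℝ => ENNReal.ofReal (-Real.log t)) (r / q)]
        rfl

lemma ae_affine_ne_zero (ν : Measure ℝ) [NullSingletonClass ν] {q : ℝ} (hq : q ≠ 0) (r : ℝ) :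
    ∀ᵐ t ∂ν, r + t * q ≠ 0 := by
  have : ∀ᵐ t ∂ν, t ≠ -r / q := by simp [ae_iff]
  filter_upwards [this] with t ht h
  exact ht (by field_simp; linarith)

/-- In the expansion along the first row, the perturbation meets one entry and none of the minors:
the determinant is affine in its corner entry, with the complementary minor as slope. -/
lemma det_add_single_zero {n : ℕ} (A : Matrix (Fin (n + 1)) (Fin (n + 1)) ℝ) (c : ℝ) :
    (A + Matrix.single 0 0 c).det = A.det + c * (A.submatrix Fin.succ Fin.succ).det := by
  have hsub : ∀ j : Fin (n + 1), (A + Matrix.single 0 0 c).submatrix Fin.succ j.succAbove =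
      A.submatrix Fin.succ j.succAbove := by
    intro j
    ext a b
    simp [(Fin.succ_ne_zero a).symm]
  rw [Matrix.det_succ_row_zero, Matrix.det_succ_row_zero A]
  simp only [hsub]
  rw [Fin.sum_univ_succ, Fin.sum_univ_succ]
  simp [(Fin.succ_ne_zero _).symm, add_mul]
  ring

variable {Ω : Type*} [MeasurableSpace Ω]

lemma measurable_det {n : ℕ} {W : Ω → Matrix (Fin n) (Fin n) ℝ}
    (hW : ∀ a b, Measurable fun x => W x a b) : Measurable fun x => (W x).det := by
  simp only [Matrix.det_apply]
  fun_prop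

/-- A random matrix whose diagonal entries can be resampled one at a time, by a law without atoms,
is almost surely invertible. -/
lemma ae_det_ne_zero_of_resample (μ : Measure Ω) [IsProbabilityMeasure μ] (ν : Measure ℝ)
    [IsProbabilityMeasure ν] [NullSingletonClass ν] {n : ℕ} (W : Ω → Matrix (Fin n) (Fin n) ℝ)
    (hW : ∀ a b, Measurable fun x => W x a b) (R : Fin n → Ω × ℝ → Ω)
    (hR : ∀ a, MeasurePreserving (R a) (μ.prod ν) μ) (z : Fin n → Ω → ℝ)
    (hWR : ∀ a x t, W (R a (x, t)) = W x + Matrix.single a a (t - z a x)) :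
    ∀ᵐ x ∂μ, (W x).det ≠ 0 := by
  induction n with
  | zero => simp
  | succ n ih =>
    have hdet := measurable_det hW
    have hsub : ∀ a b, Measurable fun x => (W x).submatrix Fin.succ Fin.succ a b :=
      fun a b => hW a.succ b.succ
    have ih' := ih (fun x => (W x).submatrix Fin.succ Fin.succ) hsub (fun a => R a.succ)
      (fun a => hR a.succ) (fun a => z a.succ) (fun a x t => by
        ext i j
        simp [hWR, Matrix.single_apply, Fin.succ_inj])
    have hset : MeasurableSet {x | (W x).det ≠ 0} := hdet (measurableSet_singleton (0 : ℝ)).compl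
    have : ∀ᵐ x ∂(μ.prod ν).map (R 0), (W x).det ≠ 0 := by
      rw [ae_map_iff (hR 0).measurable.aemeasurable hset]
      refine (Measure.ae_prod_iff_ae_ae (p := fun p => (W (R 0 p)).det ≠ 0)
        ((hR 0).measurable hset)).mpr ?_
      -- For almost every `x` the minor is nonzero by induction. The determinant is then a
      -- nonconstant affine function of the fresh entry `t`, and its single zero is not an atom.
      filter_upwards [ih'] with x hx
      filter_upwards [ae_affine_ne_zero ν hx
        ((W x).det - z 0 x * ((W x).submatrix Fin.succ Fin.succ).det)] with t ht
      rw [hWR, det_add_single_zero]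
      convert ht using 1
      ring
    rwa [(hR 0).map_eq] at this

/-- A random matrix whose diagonal entries can be resampled one at a time, by a law with bounded
density, has a log-integrable determinant. -/
lemma lintegral_neg_log_det_le_of_resample (μ : Measure Ω) [IsProbabilityMeasure μ] (ν : Measure ℝ)
    [IsProbabilityMeasure ν] [NullSingletonClass ν] {K : ℝ≥0} (hK : ν ≤ K • volume) {n : ℕ}
    (W : Ω → Matrix (Fin n) (Fin n) ℝ)
    (hW : ∀ a b, Measurable fun x => W x a b) (R : Fin n → Ω × ℝ → Ω)
    (hR : ∀ a, MeasurePreserving (R a) (μ.prod ν) μ) (z : Fin n → Ω → ℝ)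
    (hWR : ∀ a x t, W (R a (x, t)) = W x + Matrix.single a a (t - z a x)) :
    ∫⁻ x, ENNReal.ofReal (-Real.log (W x).det) ∂μ ≤
      n * (K * ∫⁻ t : ℝ, ENNReal.ofReal (-Real.log t)) := by
  induction n with
  | zero => simp
  | succ n ih =>
    have hdet := measurable_det hW
    have hsub : ∀ a b, Measurable fun x => (W x).submatrix Fin.succ Fin.succ a b :=
      fun a b => hW a.succ b.succ
    have hWR' : ∀ (a : Fin n) x t, (W (R a.succ (x, t))).submatrix Fin.succ Fin.succ =
        (W x).submatrix Fin.succ Fin.succ + Matrix.single a a (t - z a.succ x) := by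
      intro a x t
      ext i j
      simp [hWR, Matrix.single_apply, Fin.succ_inj]
    have ih' := ih (fun x => (W x).submatrix Fin.succ Fin.succ) hsub (fun a => R a.succ)
      (fun a => hR a.succ) (fun a => z a.succ) hWR'
    have hne := ae_det_ne_zero_of_resample μ ν (fun x => (W x).submatrix Fin.succ Fin.succ) hsub
      (fun a => R a.succ) (fun a => hR a.succ) (fun a => z a.succ) hWR'
    have hdetR : Measurable fun p => ENNReal.ofReal (-Real.log (W (R 0 p)).det) :=
      (hdet.comp (hR 0).measurable).log.neg.ennreal_ofReal
    rw [← (hR 0).lintegral_comp (f := fun x => ENNReal.ofReal (-Real.log (W x).det)) (by fun_prop),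
      lintegral_prod _ hdetR.aemeasurable]
    -- Integrating out the fresh corner entry first costs one constant and leaves the negative
    -- logarithm of the minor, to which the induction hypothesis applies.
    calc ∫⁻ x, ∫⁻ t, ENNReal.ofReal (-Real.log (W (R 0 (x, t))).det) ∂ν ∂μ
        ≤ ∫⁻ x, (ENNReal.ofReal (-Real.log ((W x).submatrix Fin.succ Fin.succ).det) +
            K * ∫⁻ t : ℝ, ENNReal.ofReal (-Real.log t)) ∂μ := by
          refine lintegral_mono_ae ?_
          filter_upwards [hne] with x hx
          refine le_trans (le_of_eq ?_) (lintegral_neg_log_affine_le hK hx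
            ((W x).det - z 0 x * ((W x).submatrix Fin.succ Fin.succ).det))
          refine lintegral_congr fun t => ?_
          rw [hWR, det_add_single_zero]
          congr 3
          ring
      _ = ∫⁻ x, ENNReal.ofReal (-Real.log ((W x).submatrix Fin.succ Fin.succ).det) ∂μ +
            K * ∫⁻ t : ℝ, ENNReal.ofReal (-Real.log t) := by
          rw [lintegral_add_right _ measurable_const]; simp
      _ ≤ n * (K * ∫⁻ t : ℝ, ENNReal.ofReal (-Real.log t)) +
            K * ∫⁻ t : ℝ, ENNReal.ofReal (-Real.log t) := by gcongr
      _ = _ := by push_cast; ring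

/-- Resampling one coordinate preserves a product measure. -/
lemma measurePreserving_update_pi {ι : Type*} [Fintype ι] [DecidableEq ι] {X : ι → Type*}
    [∀ i, MeasurableSpace (X i)] {T : Type*} [MeasurableSpace T] (μ : ∀ i, Measure (X i))
    [∀ i, IsProbabilityMeasure (μ i)] (τ : Measure T) [IsProbabilityMeasure τ] (i : ι)
    {φ : X i × T → X i} (hφ : MeasurePreserving φ ((μ i).prod τ) (μ i)) :
    MeasurePreserving (fun p : (∀ j, X j) × T => Function.update p.1 i (φ (p.1 i, p.2)))
      ((Measure.pi μ).prod τ) (Measure.pi μ) := by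
  have hφm := hφ.measurable
  have hm : Measurable fun p : (∀ j, X j) × T => Function.update p.1 i (φ (p.1 i, p.2)) := by
    refine measurable_pi_lambda _ fun j => ?_
    by_cases hj : j = i
    · subst hj; simp only [Function.update_self]; fun_prop
    · simp only [Function.update_of_ne hj]; fun_prop
  refine ⟨hm, (Measure.pi_eq fun s hs => ?_).symm⟩
  have hbox := MeasurableSet.univ_pi hs
  rw [Measure.map_apply hm hbox, Measure.prod_apply_symm (hm hbox)]
  -- For a fixed `t` the preimage of a box is again a box, with only the side `i` changed.
  have hslice : ∀ t, (fun x => (x, t)) ⁻¹'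
      ((fun p : (∀ j, X j) × T => Function.update p.1 i (φ (p.1 i, p.2))) ⁻¹' Set.univ.pi s) =
      Set.univ.pi (Function.update s i ((fun y => φ (y, t)) ⁻¹' s i)) := by
    intro t
    ext x
    simp only [Set.mem_preimage, Set.mem_univ_pi]
    refine forall_congr' fun j => ?_
    by_cases hj : j = i
    · subst hj; simp
    · simp [Function.update_of_ne hj]
  have hprod : ∀ t, Measure.pi μ (Set.univ.pi (Function.update s i ((fun y => φ (y, t)) ⁻¹' s i))) =
      (∏ j ∈ Finset.univ.erase i, μ j (s j)) * μ i ((fun y => φ (y, t)) ⁻¹' s i) := by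
    intro t
    rw [Measure.pi_pi, ← Finset.prod_erase_mul _ _ (Finset.mem_univ i)]
    congr 1
    · exact Finset.prod_congr rfl fun j hj => by
        rw [Function.update_of_ne (Finset.ne_of_mem_erase hj)]
    · simp
  simp_rw [hslice, hprod]
  rw [lintegral_const_mul _
    (f := fun t => μ i ((fun y => φ (y, t)) ⁻¹' s i)) (measurable_measure_prodMk_right (hφm (hs i)))]
  have := Measure.prod_apply_symm (μ := μ i) (ν := τ) (hφm (hs i))
  rw [hφ.measure_preimage (hs i).nullMeasurableSet] at this
  rw [← Finset.prod_erase_mul _ _ (Finset.mem_univ i), this]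
  rfl

end RandomDeterminant

/-! ### Rank and size of the received jamming -/

section ChannelGain

open Matrix

variable {M : Fin 2 → ℕ} {N_E N_e : ℕ}

instance (ν : Measure ℝ) [IsProbabilityMeasure ν] :
    IsProbabilityMeasure (channelUseLaw M N_e ν) := by
  unfold channelUseLaw; infer_instance

instance (ν : Measure ℝ) [IsProbabilityMeasure ν] (n : ℕ) :
    IsProbabilityMeasure (channelLaw M N_e n ν) := by
  unfold channelLaw; infer_instance

/-- The sum of the squares of all entries of the two channel matrices. -/
noncomputable def gain (h : Channel M N_e) : ℝ := ∑ i, ∑ a, ∑ m, h i a m ^ 2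

lemma gain_nonneg (h : Channel M N_e) : 0 ≤ gain h := by
  unfold gain; positivity

lemma measurable_gain : Measurable (gain : Channel M N_e → ℝ) := by
  unfold gain; fun_prop

/-- Replace one entry of a channel matrix. -/
def resample (i : Fin 2) (a : Fin N_e) (m : Fin (M i)) (p : Channel M N_e × ℝ) : Channel M N_e :=
  Function.update p.1 i (Function.update (p.1 i) a (Function.update (p.1 i a) m p.2))

/-- Resampling in a product is applied three times: to an entry of a row, to a row of a matrix, to
one of the two matrices. -/
lemma measurePreserving_resample (ν : Measure ℝ) [IsProbabilityMeasure ν] (i : Fin 2) (a : Fin N_e)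
    (m : Fin (M i)) :
    MeasurePreserving (resample i a m) ((channelUseLaw M N_e ν).prod ν)
      (channelUseLaw M N_e ν) := by
  have h0 : MeasurePreserving (Prod.snd : ℝ × ℝ → ℝ) (ν.prod ν) ν := measurePreserving_snd
  have h1 := measurePreserving_update_pi (fun _ : Fin (M i) => ν) ν m h0
  have h2 := measurePreserving_update_pi
    (fun _ : Fin N_e => Measure.pi fun _ : Fin (M i) => ν) ν a h1
  exact measurePreserving_update_pi
    (fun i : Fin 2 => Measure.pi fun _ : Fin N_e => Measure.pi fun _ : Fin (M i) => ν) ν i h2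

/-- The columns of `h i * U i` selected by `p`, over both transmitters `i`. -/
def selectedColumns {J : Fin 2 → ℕ} (U : (i : Fin 2) → Matrix (Fin (M i)) (Fin (J i)) ℝ)
    (p : Fin N_e → Σ i, Fin (J i)) (h : Channel M N_e) : Matrix (Fin N_e) (Fin N_e) ℝ :=
  Matrix.of fun a b => (Matrix.of (h (p b).1) * U (p b).1) a (p b).2

/-- The normalisation `hU` says that the rows `r i` of `U i` form an identity matrix. A channel
entry in column `r i j` therefore acts, through these rows, on the product column `j` alone. -/
lemma mul_resample {J : Fin 2 → ℕ} (U : (i : Fin 2) → Matrix (Fin (M i)) (Fin (J i)) ℝ)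
    (r : (i : Fin 2) → Fin (J i) → Fin (M i))
    (hU : ∀ i j j', U i (r i j) j' = if j = j' then 1 else 0)
    (h : Channel M N_e) (t : ℝ) (a a' : Fin N_e) (σ σ' : Σ i, Fin (J i)) :
    (Matrix.of (resample σ.1 a (r σ.1 σ.2) (h, t) σ'.1) * U σ'.1) a' σ'.2 =
      (Matrix.of (h σ'.1) * U σ'.1) a' σ'.2 +
        if a' = a ∧ σ' = σ then t - h σ.1 a (r σ.1 σ.2) else 0 := by
  obtain ⟨i, j⟩ := σ
  obtain ⟨i', j'⟩ := σ'
  simp only [Matrix.mul_apply, Matrix.of_apply, resample]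
  by_cases hi : i' = i
  · subst hi
    by_cases ha : a' = a
    · subst ha
      have hsum : ∀ m, Function.update (h i' a') (r i' j) t m * U i' m j' = h i' a' m * U i' m j' +
          if m = r i' j then (t - h i' a' (r i' j)) * U i' m j' else 0 := by
        intro m
        by_cases hm : m = r i' j
        · subst hm; simp; ring
        · simp [hm]
      simp only [Function.update_self, hsum, Finset.sum_add_distrib, Finset.sum_ite_eq',
        Finset.mem_univ, if_true, hU, true_and]
      by_cases hj : j = j'
      · subst hj; simp
      · have : ¬ ((⟨i', j'⟩ : Σ i, Fin (J i)) = ⟨i', j⟩) := by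
          simpa using fun h' => hj h'.symm
        simp [hj, this]
    · simp [ha]
  · have : ¬ ((⟨i', j'⟩ : Σ i, Fin (J i)) = ⟨i, j⟩) := fun h' => hi (congr_arg Sigma.fst h')
    simp [hi, this]

lemma selectedColumns_resample {J : Fin 2 → ℕ}
    (U : (i : Fin 2) → Matrix (Fin (M i)) (Fin (J i)) ℝ)
    (r : (i : Fin 2) → Fin (J i) → Fin (M i))
    (hU : ∀ i j j', U i (r i j) j' = if j = j' then 1 else 0)
    {p : Fin N_e → Σ i, Fin (J i)} (hp : Function.Injective p) (a : Fin N_e) (h : Channel M N_e)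
    (t : ℝ) :
    selectedColumns U p (resample (p a).1 a (r (p a).1 (p a).2) (h, t)) =
      selectedColumns U p h + Matrix.single a a (t - h (p a).1 a (r (p a).1 (p a).2)) := by
  ext a' b
  simp only [selectedColumns, Matrix.of_apply, Matrix.add_apply, Matrix.single_apply,
    mul_resample U r hU, hp.eq_iff]
  congr 1
  simp only [eq_comm]

lemma measurable_selectedColumns {J : Fin 2 → ℕ}
    (U : (i : Fin 2) → Matrix (Fin (M i)) (Fin (J i)) ℝ) (p : Fin N_e → Σ i, Fin (J i))
    (a b : Fin N_e) : Measurable fun h : Channel M N_e => selectedColumns U p h a b := by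
  simp only [selectedColumns, Matrix.of_apply, Matrix.mul_apply]
  fun_prop

/-- Cauchy-Schwarz bounds the square by a product of two square sums. The added ones make the right
side at least 1, as the adjugate estimate requires. -/
lemma abs_selectedColumns_le {J : Fin 2 → ℕ}
    (U : (i : Fin 2) → Matrix (Fin (M i)) (Fin (J i)) ℝ) (p : Fin N_e → Σ i, Fin (J i))
    (h : Channel M N_e) (a b : Fin N_e) :
    |selectedColumns U p h a b| ≤ (1 + ∑ i, ∑ m, ∑ j, U i m j ^ 2) * (1 + gain h) := by
  have hsq : selectedColumns U p h a b ^ 2 ≤ gain h * ∑ i, ∑ m, ∑ j, U i m j ^ 2 := by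
    simp only [selectedColumns, Matrix.of_apply, Matrix.mul_apply]
    refine (Finset.sum_mul_sq_le_sq_mul_sq _ _ _).trans ?_
    refine mul_le_mul ?_ ?_ (by positivity) (gain_nonneg h)
    · unfold gain
      exact (Finset.single_le_sum (f := fun a => ∑ m, h (p b).1 a m ^ 2)
        (fun _ _ => by positivity) (Finset.mem_univ a)).trans
        (Finset.single_le_sum (f := fun i => ∑ a, ∑ m, h i a m ^ 2)
        (fun _ _ => by positivity) (Finset.mem_univ _))
    · refine le_trans (Finset.sum_le_sum fun m _ => ?_)
        (Finset.single_le_sum (f := fun i => ∑ m, ∑ j, U i m j ^ 2)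
        (fun _ _ => by positivity) (Finset.mem_univ (p b).1))
      exact Finset.single_le_sum (f := fun j => U (p b).1 m j ^ 2)
        (fun _ _ => by positivity) (Finset.mem_univ _)
  have hu : 0 ≤ ∑ i, ∑ m, ∑ j, U i m j ^ 2 := by positivity
  have hg := gain_nonneg h
  refine abs_le_of_sq_le_sq ?_ (by positivity)
  refine hsq.trans ?_
  nlinarith [mul_nonneg hu hg, mul_nonneg (mul_nonneg hu hg) (mul_nonneg hu hg),
    mul_nonneg hu hu, mul_nonneg hg hg, mul_nonneg hu (mul_nonneg hg hg),
    mul_nonneg hg (mul_nonneg hu hu)]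

/-- The received jamming has full rank for almost every channel, with a quantitative lower bound
for its covariance. The bound is in terms of a function of the channel that is log-integrable when
the channel entries have a bounded density. -/
lemma exists_jamming_lower_bound (hN : N_e ≤ N_E) (S : JammingScheme M N_E) (ν : Measure ℝ)
    [IsProbabilityMeasure ν] [NullSingletonClass ν] :
    ∃ (D : Channel M N_e → ℝ) (c : ℝ) (q : ℕ), Measurable D ∧ 0 ≤ c ∧
      (∀ᵐ h ∂(channelUseLaw M N_e ν), D h ≠ 0) ∧
      ((∃ K : ℝ≥0, ν ≤ K • volume) →
        ∫⁻ h, ENNReal.ofReal (-Real.log (D h)) ∂(channelUseLaw M N_e ν) ≠ ∞) ∧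
      ∀ (h : Channel M N_e) (t : Fin N_e → ℝ), D h ^ 2 * ∑ a, t a ^ 2 ≤
        c * (1 + gain h) ^ q *
          ∑ i, S.α i / S.J i * ∑ j, ((Matrix.of (h i) * S.VJ i)ᵀ *ᵥ t) j ^ 2 := by
  choose r hr using fun i => exists_submatrix_det_ne_zero (S.VJ_linearIndependent i)
  set B : (i : Fin 2) → Matrix (Fin (S.J i)) (Fin (S.J i)) ℝ :=
    fun i => (S.VJ i).submatrix (r i) id with hB
  have hBdet : ∀ i, IsUnit (B i).det := fun i => (hr i).isUnit
  -- Column operations on `VJ i` turn an invertible block of its rows into the identity, which puts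
  -- it into the form needed for resampling.
  set U : (i : Fin 2) → Matrix (Fin (M i)) (Fin (S.J i)) ℝ := fun i => S.VJ i * (B i)⁻¹ with hUdef
  have hU : ∀ i j j', U i (r i j) j' = if j = j' then 1 else 0 := by
    intro i j j'
    have : (B i * (B i)⁻¹) j j' = (1 : Matrix _ _ ℝ) j j' := by
      rw [Matrix.mul_nonsing_inv _ (hBdet i)]
    rw [Matrix.one_apply] at this
    rw [← this]
    rfl
  -- The number of antennas enters here: `N_e` distinct jamming symbols exist because `N_e ≤ N_E = J
  -- 0 + J 1`.
  obtain ⟨p⟩ : Nonempty (Fin N_e ↪ Σ i, Fin (S.J i)) := by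
    refine Function.Embedding.nonempty_of_card_le ?_
    simp [Fintype.card_sigma, S.J_add, hN]
  set W := selectedColumns (M := M) U p with hW
  have hWm := measurable_selectedColumns (M := M) U p
  have hWR := fun a h t => selectedColumns_resample U r hU p.injective a h t
  set u : ℝ := 1 + ∑ i, ∑ m, ∑ j, U i m j ^ 2 with hu
  have hu1 : 1 ≤ u := by
    have : 0 ≤ ∑ i, ∑ m, ∑ j, U i m j ^ 2 := by positivity
    linarith
  set e : Fin 2 → ℝ := fun i => (∑ j, ∑ j', ((B i)⁻¹)ᵀ j j' ^ 2) * (S.J i / S.α i) with he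
  have he0 : ∀ i, 0 ≤ e i := fun i => by
    have := (S.α_pos i).le
    positivity
  -- The entries of `W h` are at most `u * (1 + gain h)`; the squared adjugate bound raises this to
  -- the power `2 * N_e`. The numbers `e i` undo the normalisation by `B i` and the weights `α i / J
  -- i`.
  refine ⟨fun h => (W h).det, (N_e : ℝ) ^ 2 * (N_e.factorial * u ^ N_e) ^ 2 * ∑ i, e i, 2 * N_e,
    measurable_det hWm, ?_, ?_, ?_, ?_⟩
  · have : 0 ≤ ∑ i, e i := Finset.sum_nonneg fun i _ => he0 i
    positivity
  · exact ae_det_ne_zero_of_resample _ ν W hWm _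
      (fun a => measurePreserving_resample ν (p a).1 a (r (p a).1 (p a).2)) _ hWR
  · rintro ⟨K, hK⟩
    refine ne_top_of_le_ne_top ?_ (lintegral_neg_log_det_le_of_resample _ ν hK W hWm _
      (fun a => measurePreserving_resample ν (p a).1 a (r (p a).1 (p a).2)) _ hWR)
    exact ENNReal.mul_ne_top (by simp)
      (ENNReal.mul_ne_top (by simp) lintegral_neg_log_lt_top.ne)
  · intro h t
    have hg := gain_nonneg h
    set s : Fin 2 → ℝ := fun i => S.α i / S.J i * ∑ j, ((Matrix.of (h i) * S.VJ i)ᵀ *ᵥ t) j ^ 2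
    have hs0 : ∀ i, 0 ≤ s i := fun i => by
      have := (S.α_pos i).le
      positivity
    have hy : ∀ i, ∑ j, ((Matrix.of (h i) * U i)ᵀ *ᵥ t) j ^ 2 ≤ e i * s i := by
      intro i
      -- Without jamming symbols `J i / α i` is not the inverse of `α i / J i`, but the sum on the
      -- left is empty.
      rcases Nat.eq_zero_or_pos (S.J i) with hJ | hJ
      · have : IsEmpty (Fin (S.J i)) := by rw [hJ]; infer_instance
        simpa using mul_nonneg (he0 i) (hs0 i)
      have h1 : (Matrix.of (h i) * U i)ᵀ *ᵥ t =
          ((B i)⁻¹)ᵀ *ᵥ ((Matrix.of (h i) * S.VJ i)ᵀ *ᵥ t) := by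
        rw [mulVec_mulVec, ← transpose_mul, Matrix.mul_assoc]
      rw [h1]
      refine (sum_sq_mulVec_le _ _).trans (le_of_eq ?_)
      have := (S.α_pos i).ne'
      have hJ' : (S.J i : ℝ) ≠ 0 := by positivity
      simp only [he, s]
      field_simp
    have hcol : ∑ b, ((W h)ᵀ *ᵥ t) b ^ 2 ≤ (∑ i, e i) * ∑ i, s i := by
      calc ∑ b, ((W h)ᵀ *ᵥ t) b ^ 2
          = ∑ b, ((Matrix.of (h (p b).1) * U (p b).1)ᵀ *ᵥ t) (p b).2 ^ 2 := rfl
        _ = ∑ σ ∈ Finset.univ.map p, ((Matrix.of (h σ.1) * U σ.1)ᵀ *ᵥ t) σ.2 ^ 2 := by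
            rw [Finset.sum_map]
        _ ≤ ∑ σ : Σ i, Fin (S.J i), ((Matrix.of (h σ.1) * U σ.1)ᵀ *ᵥ t) σ.2 ^ 2 :=
            Finset.sum_le_sum_of_subset_of_nonneg (Finset.subset_univ _)
              fun _ _ _ => by positivity
        _ = ∑ i, ∑ j, ((Matrix.of (h i) * U i)ᵀ *ᵥ t) j ^ 2 := Fintype.sum_sigma _
        _ ≤ ∑ i, e i * s i := Finset.sum_le_sum fun i _ => hy i
        _ ≤ (∑ i, e i) * ∑ i, s i := by
            rw [Finset.mul_sum]
            refine Finset.sum_le_sum fun i _ => mul_le_mul_of_nonneg_right ?_ (hs0 i)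
            exact Finset.single_le_sum (fun i _ => he0 i) (Finset.mem_univ i)
    have hdet := det_sq_mul_sum_sq_le (W h)ᵀ (w := u * (1 + gain h)) (by nlinarith)
      (fun a b => abs_selectedColumns_le U p h b a) t
    rw [det_transpose, Fintype.card_fin, mul_pow u] at hdet
    refine hdet.trans ((mul_le_mul_of_nonneg_left hcol (by positivity)).trans (le_of_eq ?_))
    ring

end ChannelGain

end Wiretap

namespace Wiretap

/-! ### Linear images of Gaussian vectors and second-moment matrices -/

section GaussianVectors

open Matrix

lemma charFunDual_gaussianReal_zero (v : ℝ≥0) (L : StrongDual ℝ ℝ) :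
    charFunDual (gaussianReal 0 v) L = Complex.exp ((-(v * L 1 ^ 2) / 2 : ℝ)) := by
  rw [charFunDual_eq_charFun_map_one, gaussianReal_map_continuousLinearMap, charFun_gaussianReal]
  have : (((L 1 ^ 2).toNNReal * v : ℝ≥0) : ℝ) = L 1 ^ 2 * v := by
    rw [NNReal.coe_mul, Real.coe_toNNReal _ (sq_nonneg _)]
  simp [this]
  ring_nf

/-- Characteristic functionals require no densities, so vanishing variances and singular matrices
are covered. -/
lemma charFunDual_pi_gaussianReal_zero {ι : Type*} [Fintype ι] [DecidableEq ι] (v : ι → ℝ≥0)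
    (L : StrongDual ℝ (ι → ℝ)) :
    charFunDual (Measure.pi fun i => gaussianReal 0 (v i)) L =
      Complex.exp ((-(∑ i, v i * L (Pi.single i 1) ^ 2) / 2 : ℝ)) := by
  rw [charFunDual_pi]
  simp only [charFunDual_gaussianReal_zero]
  rw [← Complex.exp_sum, ← Complex.ofReal_sum]
  congr 2
  simp [neg_div, Finset.sum_div]

/-- The whitened sum of coloured and white Gaussian noise is a standard Gaussian vector. -/
lemma map_whitening_eq_pi_gaussianReal {I : Type*} [Fintype I] [DecidableEq I] {J : I → ℕ} {N : ℕ}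
    (v : I → ℝ≥0) (σ2 : ℝ≥0) (A : (i : I) → Matrix (Fin N) (Fin (J i)) ℝ)
    {T : Matrix (Fin N) (Fin N) ℝ}
    (hT : T * ((σ2 : ℝ) • (1 : Matrix (Fin N) (Fin N) ℝ) + ∑ i, (v i : ℝ) • (A i * (A i)ᵀ)) * Tᵀ
      = 1) :
    ((Measure.pi fun i => Measure.pi fun _ : Fin (J i) => gaussianReal 0 (v i)).prod
      (Measure.pi fun _ : Fin N => gaussianReal 0 σ2)).map
        (fun p => T *ᵥ (∑ i, A i *ᵥ p.1 i + p.2)) =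
      Measure.pi fun _ => gaussianReal 0 1 := by
  let F₀ : ((i : I) → Fin (J i) → ℝ) × (Fin N → ℝ) →ₗ[ℝ] (Fin N → ℝ) :=
    T.mulVecLin ∘ₗ ((∑ i, (A i).mulVecLin ∘ₗ LinearMap.proj i ∘ₗ LinearMap.fst ℝ _ _) +
      LinearMap.snd ℝ _ _)
  let F : ((i : I) → Fin (J i) → ℝ) × (Fin N → ℝ) →L[ℝ] (Fin N → ℝ) :=
    LinearMap.toContinuousLinearMap F₀
  have hF : ∀ p, F p = T *ᵥ (∑ i, A i *ᵥ p.1 i + p.2) := by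
    intro p
    simp [F, F₀, LinearMap.sum_apply]
  have hF' : (fun p : ((i : I) → Fin (J i) → ℝ) × (Fin N → ℝ) =>
      T *ᵥ (∑ i, A i *ᵥ p.1 i + p.2)) = F := funext fun p => (hF p).symm
  rw [hF']
  have : IsProbabilityMeasure (((Measure.pi fun i => Measure.pi fun _ : Fin (J i) =>
      gaussianReal 0 (v i)).prod (Measure.pi fun _ : Fin N => gaussianReal 0 σ2)).map F) :=
    Measure.isProbabilityMeasure_map F.measurable.aemeasurable
  refine Measure.ext_of_charFunDual ?_
  ext L
  rw [charFunDual_map, charFunDual_prod, charFunDual_pi, charFunDual_pi_gaussianReal_zero,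
    charFunDual_pi_gaussianReal_zero]
  simp only [charFunDual_pi_gaussianReal_zero]
  rw [← Complex.exp_sum, ← Complex.exp_add, ← Complex.ofReal_sum, ← Complex.ofReal_add]
  congr 2
  set l : Fin N → ℝ := fun a => L (Pi.single a 1) with hl
  have hL : ∀ x, L x = l ⬝ᵥ x := by
    intro x
    conv_lhs => rw [pi_eq_sum_univ' x]
    simp [dotProduct, hl, mul_comm]
  set w := l ᵥ* T with hw
  have h1 : ∀ i j, L (F ((Pi.single i (Pi.single j 1) : (i : I) → Fin (J i) → ℝ), 0)) =
      (w ᵥ* A i) j := by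
    intro i j
    have : ∑ i', A i' *ᵥ (Pi.single i (Pi.single j 1) : (i : I) → Fin (J i) → ℝ) i' =
        A i *ᵥ Pi.single j 1 := by
      rw [Finset.sum_eq_single i]
      · simp
      · intro b _ hb
        simp [Pi.single_eq_of_ne hb]
      · simp
    rw [hF, hL]
    simp only [this, add_zero]
    rw [mulVec_mulVec, dotProduct_mulVec, ← vecMul_vecMul, ← hw]
    simp
  have h2 : ∀ a, L (F (0, Pi.single a 1)) = w a := by
    intro a
    rw [hF, hL]
    simp [hw]
    rfl
  -- Equality of the exponents is the whitening identity `hT` evaluated as a quadratic form at `l`.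
  have hquad : ∑ i, ∑ j, (v i : ℝ) * (w ᵥ* A i) j ^ 2 + ∑ a, (σ2 : ℝ) * w a ^ 2 =
      ∑ a, l a ^ 2 := by
    have e1 : l ⬝ᵥ (T * ((σ2 : ℝ) • (1 : Matrix (Fin N) (Fin N) ℝ) +
        ∑ i, (v i : ℝ) • (A i * (A i)ᵀ)) * Tᵀ) *ᵥ l = ∑ a, l a ^ 2 := by
      rw [hT, one_mulVec]
      simp [dotProduct, sq]
    rw [← e1, ← mulVec_mulVec, ← mulVec_mulVec, dotProduct_mulVec, ← hw, mulVec_transpose, ← hw,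
      add_mulVec, dotProduct_add, smul_mulVec, one_mulVec, dotProduct_smul, sum_mulVec,
      dotProduct_sum, add_comm]
    congr 1
    · simp [dotProduct, sq, Finset.mul_sum]
    · refine Finset.sum_congr rfl fun i _ => ?_
      rw [smul_mulVec, dotProduct_smul, ← mulVec_mulVec, dotProduct_mulVec, mulVec_transpose]
      simp [dotProduct, sq, Finset.mul_sum]
  have hgoal : ∑ i, -(∑ j, (v i : ℝ) * L (F ((Pi.single i (Pi.single j 1) :
      (i : I) → Fin (J i) → ℝ), 0)) ^ 2) / 2 + -(∑ a, (σ2 : ℝ) * L (F (0, Pi.single a 1)) ^ 2) / 2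
      = -(∑ a, ((1 : ℝ≥0) : ℝ) * L (Pi.single a 1) ^ 2) / 2 := by
    simp only [h1, h2]
    have : ∀ a, L (Pi.single a 1) = l a := fun _ => rfl
    simp only [this, NNReal.coe_one, one_mul, ← hquad, ← Finset.sum_div, Finset.sum_neg_distrib]
    ring
  exact hgoal

lemma dotProduct_secondMoment_mulVec {Ω : Type*} [MeasurableSpace Ω] (μ : Measure Ω) {N : ℕ}
    {u : Ω → Fin N → ℝ} (hu : ∀ a, MemLp (fun ω => u ω a) 2 μ) (x y : Fin N → ℝ) :
    x ⬝ᵥ (Matrix.of fun a b => ∫ ω, u ω a * u ω b ∂μ) *ᵥ y =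
      ∫ ω, (x ⬝ᵥ u ω) * (y ⬝ᵥ u ω) ∂μ := by
  have hi : ∀ a b, Integrable (fun ω => u ω a * u ω b) μ := fun a b => (hu a).integrable_mul (hu b)
  have h : ∀ ω, (x ⬝ᵥ u ω) * (y ⬝ᵥ u ω) = ∑ a, ∑ b, x a * y b * (u ω a * u ω b) := by
    intro ω
    rw [dotProduct, dotProduct, Finset.sum_mul_sum]
    exact Finset.sum_congr rfl fun a _ => Finset.sum_congr rfl fun b _ => by ring
  simp only [h]
  rw [integral_finsetSum _ fun a _ => integrable_finsetSum _ fun b _ => (hi a b).const_mul _]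
  simp only [dotProduct, mulVec, of_apply, Finset.mul_sum]
  refine Finset.sum_congr rfl fun a _ => ?_
  rw [integral_finsetSum _ fun b _ => (hi a b).const_mul _]
  refine Finset.sum_congr rfl fun b _ => ?_
  rw [integral_const_mul]
  ring

lemma posSemidef_secondMoment {Ω : Type*} [MeasurableSpace Ω] (μ : Measure Ω) {N : ℕ}
    {u : Ω → Fin N → ℝ} (hu : ∀ a, MemLp (fun ω => u ω a) 2 μ) :
    (Matrix.of fun a b => ∫ ω, u ω a * u ω b ∂μ).PosSemidef := by
  refine Matrix.PosSemidef.of_dotProduct_mulVec_nonneg ?_ fun x => ?_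
  · ext a b
    simp [mul_comm]
  · rw [star_trivial, dotProduct_secondMoment_mulVec μ hu]
    exact integral_nonneg fun ω => mul_self_nonneg _

end GaussianVectors

/-! ### Information about the source for a given channel block -/

section BlockRate

open Matrix InformationTheory

variable {M : Fin 2 → ℕ} {N_E : ℕ} {L : Fin 2 → ℕ} {n : ℕ}

instance (c : Code L n) : IsProbabilityMeasure c.sourceLaw := by
  have h (i : Fin 2) : NeZero (c.card i) := ⟨(c.card_pos i).ne'⟩
  have h2 (i : Fin 2) : IsProbabilityMeasure (uniformOn (Set.univ : Set (Fin (c.card i)))) :=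
    isProbabilityMeasure_uniformOn Set.finite_univ Set.univ_nonempty
  have := c.markov
  unfold Code.sourceLaw
  infer_instance

instance (c : Code L n) : Nonempty c.Source := by
  have h (i : Fin 2) : NeZero (c.card i) := ⟨(c.card_pos i).ne'⟩
  infer_instance

instance (S : JammingScheme M N_E) (P : ℝ) : IsProbabilityMeasure (S.jamLaw P n) := by
  unfold JammingScheme.jamLaw; infer_instance

instance (σ2 : ℝ≥0) (N_e : ℕ) : IsProbabilityMeasure (noiseLaw σ2 N_e n) := by
  unfold noiseLaw; infer_instance

instance (S : JammingScheme M N_E) (σ2 : ℝ≥0) (N_e : ℕ) (P : ℝ) (c : Code S.L n) :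
    IsProbabilityMeasure (S.law σ2 N_e P c) := by
  unfold JammingScheme.law; infer_instance

variable {N_e : ℕ} (S : JammingScheme M N_E) (c : Code S.L n) (g : Fin n → Channel M N_e)

/-- The legitimate part of what the eavesdropper receives in use `k`. -/
noncomputable def JammingScheme.receivedSignal (w : c.Source) (k : Fin n) : Fin N_e → ℝ :=
  ∑ i, (Matrix.of (g k i) * S.VL i) *ᵥ (w i).2 k

lemma measurable_receivedSignal (k : Fin n) (a : Fin N_e) :
    Measurable fun w => S.receivedSignal c g w k a := by
  simp only [JammingScheme.receivedSignal, Finset.sum_apply, mulVec, dotProduct]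
  fun_prop

lemma received_eq (ω : c.Source × Jam S.J n × Block N_e n) (k : Fin n) :
    S.received c g ω k = S.receivedSignal c g ω.1 k +
      (∑ i, (Matrix.of (g k i) * S.VJ i) *ᵥ ω.2.1 k i + ω.2.2 k) := by
  simp only [JammingScheme.received, JammingScheme.sent, JammingScheme.receivedSignal, mulVec_add,
    mulVec_mulVec, Finset.sum_add_distrib, add_assoc]

lemma measurable_received :
    Measurable fun p : (c.Source × Jam S.J n × Block N_e n) × (Fin n → Channel M N_e) =>
      S.received c p.2 p.1 := by
  refine measurable_pi_lambda _ fun k => measurable_pi_lambda _ fun a => ?_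
  simp only [JammingScheme.received, JammingScheme.sent, Finset.sum_apply, Pi.add_apply, mulVec,
    dotProduct, of_apply]
  fun_prop

lemma measurable_received_apply : Measurable (S.received c g) := by
  have h := (measurable_received (N_e := N_e) S c).comp
    (measurable_id.prodMk (measurable_const (a := g)))
  exact h

lemma signalCov_eq (k : Fin n) : S.signalCov c g k = Matrix.of fun a b =>
    ∫ w, S.receivedSignal c g w k a * S.receivedSignal c g w k b ∂c.sourceLaw := rfl

lemma posSemidef_jamCov {P : ℝ} (hP : 0 ≤ P) (h : Channel M N_e) :
    (S.jamCov P h).PosSemidef := by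
  refine posSemidef_sum _ fun i _ => ?_
  have : 0 ≤ S.jamPower P i := by
    have := (S.α_pos i).le
    unfold JammingScheme.jamPower; positivity
  have h2 := posSemidef_self_mul_conjTranspose (Matrix.of (h i) * S.VJ i)
  rw [conjTranspose_eq_transpose_of_trivial] at h2
  exact h2.smul this

lemma posDef_noise_add_jamCov {P : ℝ} (hP : 0 ≤ P) {σ2 : ℝ≥0} (hσ : 0 < σ2) (h : Channel M N_e) :
    ((σ2 : ℝ) • (1 : Matrix (Fin N_e) (Fin N_e) ℝ) + S.jamCov P h).PosDef :=
  (PosDef.one.smul (by exact_mod_cast hσ)).add_posSemidef (posSemidef_jamCov S hP h)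

/-- The whitened jamming and noise over a block are independent standard Gaussian variables. -/
lemma map_whitened_jamming_noise {P : ℝ} (hP : 0 ≤ P) (σ2 : ℝ≥0)
    {T : Fin n → Matrix (Fin N_e) (Fin N_e) ℝ}
    (hT : ∀ k, T k * ((σ2 : ℝ) • (1 : Matrix (Fin N_e) (Fin N_e) ℝ) + S.jamCov P (g k)) * (T k)ᵀ
      = 1) :
    ((S.jamLaw P n).prod (noiseLaw σ2 N_e n)).map
        (fun p k => T k *ᵥ (∑ i, (Matrix.of (g k i) * S.VJ i) *ᵥ p.1 k i + p.2 k)) =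
      Measure.pi fun _ => Measure.pi fun _ => gaussianReal 0 1 := by
  have hjam : ∀ i, (((S.jamPower P i).toNNReal : ℝ≥0) : ℝ) = S.jamPower P i := fun i => by
    refine Real.coe_toNNReal _ ?_
    have := (S.α_pos i).le
    unfold JammingScheme.jamPower; positivity
  have hk := fun k => map_whitening_eq_pi_gaussianReal (fun i => (S.jamPower P i).toNNReal) σ2
    (fun i => Matrix.of (g k i) * S.VJ i) (T := T k) (by simpa only [hjam, JammingScheme.jamCov] using hT k)
  -- Jamming block and noise block are regrouped use by use, so that the whitening acts on
  -- independent factors.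
  have e := measurePreserving_arrowProdEquivProdArrow ((i : Fin 2) → Fin (S.J i) → ℝ)
    (Fin N_e → ℝ) (Fin n)
    (fun _ => Measure.pi fun i => Measure.pi fun _ => gaussianReal 0 (S.jamPower P i).toNNReal)
    (fun _ => Measure.pi fun _ => gaussianReal 0 σ2)
  have hm : ∀ k, Measurable fun p : ((i : Fin 2) → Fin (S.J i) → ℝ) × (Fin N_e → ℝ) =>
      T k *ᵥ (∑ i, (Matrix.of (g k i) * S.VJ i) *ᵥ p.1 i + p.2) := by
    intro k
    refine measurable_pi_lambda _ fun a => ?_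
    simp only [mulVec, dotProduct, Finset.sum_apply, Pi.add_apply]
    fun_prop
  have hm' : Measurable fun (p : Jam S.J n × Block N_e n) k =>
      T k *ᵥ (∑ i, (Matrix.of (g k i) * S.VJ i) *ᵥ p.1 k i + p.2 k) := by
    refine measurable_pi_lambda _ fun k => measurable_pi_lambda _ fun a => ?_
    simp only [mulVec, dotProduct, Finset.sum_apply, Pi.add_apply]
    fun_prop
  rw [JammingScheme.jamLaw, noiseLaw, ← e.map_eq, Measure.map_map hm' e.measurable]
  have hprob : ∀ k, IsProbabilityMeasure
      (((Measure.pi fun i => Measure.pi fun _ : Fin (S.J i) =>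
        gaussianReal 0 (S.jamPower P i).toNNReal).prod
      (Measure.pi fun _ : Fin N_e => gaussianReal 0 σ2)).map fun p =>
        T k *ᵥ (∑ i, (Matrix.of (g k i) * S.VJ i) *ᵥ p.1 i + p.2)) :=
    fun k => Measure.isProbabilityMeasure_map (hm k).aemeasurable
  have := Measure.pi_map_pi (μ := fun _ : Fin n =>
      (Measure.pi fun i => Measure.pi fun _ : Fin (S.J i) =>
        gaussianReal 0 (S.jamPower P i).toNNReal).prod
      (Measure.pi fun _ : Fin N_e => gaussianReal 0 σ2)) (fun k => (hm k).aemeasurable)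
  simp only [hk] at this
  rw [← this]
  rfl

lemma map_add_pi_gaussianReal (m : Fin n → Fin N_e → ℝ) :
    (Measure.pi fun _ : Fin n => Measure.pi fun _ : Fin N_e => gaussianReal 0 1).map
      (fun x k a => m k a + x k a) =
    Measure.pi fun k => Measure.pi fun a => gaussianReal (m k a) 1 := by
  have hm (k : Fin n) : Measurable fun (x : Fin N_e → ℝ) a => m k a + x a :=
    measurable_pi_lambda _ fun a => by fun_prop
  have h1 : ∀ k, (Measure.pi fun _ : Fin N_e => gaussianReal 0 1).map (fun x a => m k a + x a) =
      Measure.pi fun a => gaussianReal (m k a) 1 := by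
    intro k
    have (a : Fin N_e) : IsProbabilityMeasure ((gaussianReal 0 1).map fun x => m k a + x) :=
      Measure.isProbabilityMeasure_map (by fun_prop)
    rw [Measure.pi_map_pi (fun a => by fun_prop)]
    simp [gaussianReal_map_const_add]
  have (k : Fin n) : IsProbabilityMeasure ((Measure.pi fun _ : Fin N_e => gaussianReal 0 1).map
      (fun x a => m k a + x a)) := Measure.isProbabilityMeasure_map (hm k).aemeasurable
  have h2 := Measure.pi_map_pi (μ := fun _ : Fin n => Measure.pi fun _ : Fin N_e => gaussianReal 0 1)
    (f := fun k x a => m k a + x a) (fun k => (hm k).aemeasurable)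
  simp only [h1] at h2
  exact h2

/-- The variance `1 + d` matches the mean of `1 + m ^ 2`, so the quadratic term averages to 1 and
cancels; only the logarithm survives. Only the second moment of `m` matters, not its law. -/
lemma lintegral_gaussian_divergence {Ω : Type*} [MeasurableSpace Ω] (μ : Measure Ω)
    [IsProbabilityMeasure μ] {m : Ω → ℝ} (hm : MemLp m 2 μ) {d : ℝ} (hd : 0 ≤ d)
    (hmd : ∫ ω, m ω ^ 2 ∂μ = d) :
    ∫⁻ ω, ENNReal.ofReal (1 / 2 * (Real.log (1 + d) + (1 + m ω ^ 2) / (1 + d) - 1)) ∂μ =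
      ENNReal.ofReal (1 / 2 * Real.log (1 + d)) := by
  have hsq : Integrable (fun ω => m ω ^ 2) μ := hm.integrable_sq
  have hi1 : Integrable (fun ω => (1 + m ω ^ 2) / (1 + d)) μ :=
    ((integrable_const _).add hsq).div_const _
  have hi : Integrable (fun ω => 1 / 2 * (Real.log (1 + d) + (1 + m ω ^ 2) / (1 + d) - 1)) μ :=
    (((integrable_const _).add hi1).sub (integrable_const _)).const_mul _
  rw [← ofReal_integral_eq_lintegral_ofReal hi]
  · congr 1
    have e1 := integral_add (integrable_const (μ := μ) (Real.log (1 + d))) hi1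
    have e2 := integral_sub ((integrable_const (μ := μ) (Real.log (1 + d))).add hi1)
      (integrable_const (1 : ℝ))
    have e3 := integral_add (integrable_const (μ := μ) (1 : ℝ)) hsq
    simp only [Pi.add_apply, integral_const, probReal_univ, smul_eq_mul, one_mul] at e1 e2 e3
    rw [integral_const_mul, e2, e1, integral_div, e3, hmd, div_self (by linarith)]
    ring
  · refine .of_forall fun ω => ?_
    have h1 := Real.one_sub_inv_le_log_of_pos (show 0 < 1 + d by linarith)
    have h2 : (1 + d)⁻¹ ≤ (1 + m ω ^ 2) / (1 + d) := by
      rw [inv_eq_one_div]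
      gcongr
      nlinarith [sq_nonneg (m ω)]
    simp only [Pi.zero_apply]
    linarith

/-- The information of the eavesdropper about the source, for a given channel block, in terms of the
whitened second moments of the received signal. -/
lemma mutualInfo_source_le {P : ℝ} (hP : 0 ≤ P) (σ2 : ℝ≥0)
    (hu : ∀ k a, MemLp (fun w => S.receivedSignal c g w k a) 2 c.sourceLaw)
    {T : Fin n → Matrix (Fin N_e) (Fin N_e) ℝ} {d : Fin n → Fin N_e → ℝ} (hd : ∀ k a, 0 ≤ d k a)
    (hT : ∀ k, T k * ((σ2 : ℝ) • (1 : Matrix (Fin N_e) (Fin N_e) ℝ) + S.jamCov P (g k)) * (T k)ᵀ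
      = 1)
    (hTS : ∀ k, T k * S.signalCov c g k * (T k)ᵀ = diagonal (d k)) :
    mutualInfo (S.law σ2 N_e P c) Prod.fst (S.received c g) ≤
      ENNReal.ofReal (∑ k, ∑ a, 1 / 2 * Real.log (1 + d k a)) := by
  set white : Block N_e n → Block N_e n := fun y k => T k *ᵥ y k with hwhite
  set unwhite : Block N_e n → Block N_e n := fun y k => (T k)⁻¹ *ᵥ y k with hunwhite
  have hTdet : ∀ k, IsUnit (T k).det := fun k => by
    have := congr_arg det (hT k)
    rw [Matrix.mul_assoc, det_mul, det_one] at this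
    exact IsUnit.of_mul_eq_one _ this
  have hwm : Measurable white := by
    refine measurable_pi_lambda _ fun k => measurable_pi_lambda _ fun a => ?_
    simp only [hwhite, mulVec, dotProduct]
    fun_prop
  have hum : Measurable unwhite := by
    refine measurable_pi_lambda _ fun k => measurable_pi_lambda _ fun a => ?_
    simp only [hunwhite, mulVec, dotProduct]
    fun_prop
  have hinv : ∀ y, unwhite (white y) = y := by
    intro y
    ext1 k
    simp [hwhite, hunwhite, mulVec_mulVec, nonsing_inv_mul _ (hTdet k)]
  have hrec := measurable_received_apply S c g
  -- Whitening is invertible, so it loses no information.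
  refine (mutualInfo_le_of_leftInverse _ measurable_fst hrec hwm hum hinv).trans ?_
  set m : c.Source → Fin n → Fin N_e → ℝ := fun w k => T k *ᵥ S.receivedSignal c g w k with hm
  have hsplit : ∀ w (p : Jam S.J n × Block N_e n), white (S.received c g (w, p)) =
      fun k a => m w k a +
        (T k *ᵥ (∑ i, (Matrix.of (g k i) * S.VJ i) *ᵥ p.1 k i + p.2 k)) a := by
    intro w p
    ext k a
    simp only [hwhite, received_eq, mulVec_add, hm, Pi.add_apply]
  have hnoise_m : Measurable fun (p : Jam S.J n × Block N_e n) k =>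
      T k *ᵥ (∑ i, (Matrix.of (g k i) * S.VJ i) *ᵥ p.1 k i + p.2 k) := by
    refine measurable_pi_lambda _ fun k => measurable_pi_lambda _ fun a => ?_
    simp only [mulVec, dotProduct, Finset.sum_apply, Pi.add_apply]
    fun_prop
  have hlaw : ∀ w, ((S.jamLaw P n).prod (noiseLaw σ2 N_e n)).map
      (fun p => white (S.received c g (w, p))) =
      Measure.pi fun k => Measure.pi fun a => gaussianReal (m w k a) 1 := by
    intro w
    rw [← map_add_pi_gaussianReal (m w), ← map_whitened_jamming_noise S g hP σ2 hT,
      Measure.map_map (by fun_prop) hnoise_m]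
    simp only [hsplit]
    rfl
  -- The reference law has the second moment of each whitened output coordinate: unit noise plus
  -- signal `d k a`.
  set v : Fin n → Fin N_e → ℝ≥0 := fun k a => (1 + d k a).toNNReal with hv
  have hvc : ∀ k a, ((v k a : ℝ≥0) : ℝ) = 1 + d k a := fun k a =>
    Real.coe_toNNReal _ (by linarith [hd k a])
  have hv0 : ∀ k a, v k a ≠ 0 := fun k a h => by
    have := hvc k a
    rw [h, NNReal.coe_zero] at this
    linarith [hd k a]
  have hkl : ∀ w, klDiv (((S.jamLaw P n).prod (noiseLaw σ2 N_e n)).map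
      (fun p => white (S.received c g (w, p))))
      (Measure.pi fun k => Measure.pi fun a => gaussianReal 0 (v k a)) ≤
      ∑ k, ∑ a, ENNReal.ofReal
        (1 / 2 * (Real.log (1 + d k a) + (1 + m w k a ^ 2) / (1 + d k a) - 1)) := by
    intro w
    rw [hlaw]
    refine (klDiv_pi_le _ _).trans (Finset.sum_le_sum fun k _ => (klDiv_pi_le _ _).trans
      (Finset.sum_le_sum fun a _ => ?_))
    rw [klDiv_gaussianReal _ (hv0 k a), hvc]
  have hmain := mutualInfo_le_lintegral_klDiv (f := fun ω => white (S.received c g ω)) ((S.jamLaw P n).prod (noiseLaw σ2 N_e n))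
    c.sourceLaw (hwm.comp hrec) (Measure.pi fun k => Measure.pi fun a => gaussianReal 0 (v k a)) _
    (fun w => (ENNReal.sum_lt_top.mpr fun _ _ => ENNReal.sum_lt_top.mpr fun _ _ =>
      ENNReal.ofReal_lt_top).ne) hkl
  rw [JammingScheme.law]
  refine hmain.trans (le_of_eq ?_)
  have hmm : ∀ k a, MemLp (fun w => m w k a) 2 c.sourceLaw := by
    intro k a
    simp only [hm, mulVec, dotProduct]
    exact memLp_finsetSum _ fun b _ => (hu k b).const_mul _
  have hmd : ∀ k a, ∫ w, m w k a ^ 2 ∂c.sourceLaw = d k a := by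
    intro k a
    have h1 := dotProduct_secondMoment_mulVec c.sourceLaw (hu k) (T k a) (T k a)
    rw [← signalCov_eq] at h1
    have h2 : (T k * S.signalCov c g k * (T k)ᵀ) a a = d k a := by rw [hTS]; simp
    rw [← h2, Matrix.mul_assoc]
    refine Eq.trans ?_ (h1.symm.trans ?_)
    · exact integral_congr_ae (.of_forall fun w => sq _)
    · rfl
  have hmeas : ∀ k a, Measurable fun w => m w k a := by
    intro k a
    have := measurable_receivedSignal S c g k
    simp only [hm, mulVec, dotProduct]
    fun_prop
  rw [lintegral_finsetSum _ fun k _ => Finset.measurable_sum _ fun a _ =>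
    Measurable.ennreal_ofReal (by have := hmeas k a; fun_prop)]
  rw [ENNReal.ofReal_sum_of_nonneg fun k _ => Finset.sum_nonneg fun a _ =>
    mul_nonneg (by norm_num) (Real.log_nonneg (by linarith [hd k a]))]
  refine Finset.sum_congr rfl fun k _ => ?_
  rw [lintegral_finsetSum _ fun a _ =>
    Measurable.ennreal_ofReal (by have := hmeas k a; fun_prop)]
  rw [ENNReal.ofReal_sum_of_nonneg fun a _ =>
    mul_nonneg (by norm_num) (Real.log_nonneg (by linarith [hd k a]))]
  exact Finset.sum_congr rfl fun a _ =>
    lintegral_gaussian_divergence _ (hmm k a) (hd k a) (hmd k a)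

end BlockRate

end Wiretap

namespace Wiretap

open Matrix

/-! ### Power of the legitimate signal -/

section Power

lemma ofReal_le_lintegral_of_symmetric {Ω : Type*} [MeasurableSpace Ω] [Neg Ω] {ρ : Measure Ω}
    [IsProbabilityMeasure ρ] (hρ : MeasurePreserving (fun r : Ω => -r) ρ ρ) {f : Ω → ℝ}
    (hf : Measurable f) (hf0 : ∀ r, 0 ≤ f r) {A : ℝ} (hA : ∀ r, 2 * A ≤ f r + f (-r)) :
    ENNReal.ofReal A ≤ ∫⁻ r, ENNReal.ofReal (f r) ∂ρ := by
  have h1 : ∫⁻ r, ENNReal.ofReal (f (-r)) ∂ρ = ∫⁻ r, ENNReal.ofReal (f r) ∂ρ :=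
    hρ.lintegral_comp (f := fun r => ENNReal.ofReal (f r)) hf.ennreal_ofReal
  have h2 : 2 * ENNReal.ofReal A ≤ 2 * ∫⁻ r, ENNReal.ofReal (f r) ∂ρ := by
    calc 2 * ENNReal.ofReal A = ∫⁻ _, ENNReal.ofReal (2 * A) ∂ρ := by
          rw [lintegral_const, measure_univ, mul_one, ENNReal.ofReal_mul zero_le_two,
            ENNReal.ofReal_ofNat]
      _ ≤ ∫⁻ r, (ENNReal.ofReal (f r) + ENNReal.ofReal (f (-r))) ∂ρ := by
          refine lintegral_mono fun r => ?_
          rw [← ENNReal.ofReal_add (hf0 _) (hf0 _)]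
          exact ENNReal.ofReal_le_ofReal (hA r)
      _ = 2 * ∫⁻ r, ENNReal.ofReal (f r) ∂ρ := by
          rw [lintegral_add_left hf.ennreal_ofReal, h1, two_mul]
  exact (ENNReal.mul_le_mul_iff_right two_ne_zero ENNReal.ofNat_ne_top).mp h2

variable {M : Fin 2 → ℕ} {N_E N_e n : ℕ} (S : JammingScheme M N_E) (c : Code S.L n)

lemma measurePreserving_neg_jamLaw (P : ℝ) :
    MeasurePreserving (fun r : Jam S.J n => -r) (S.jamLaw P n) (S.jamLaw P n) := by
  have h (i : Fin 2) : MeasurePreserving (fun x : ℝ => -x)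
      (gaussianReal 0 (S.jamPower P i).toNNReal) (gaussianReal 0 (S.jamPower P i).toNNReal) :=
    ⟨measurable_neg, by rw [gaussianReal_map_neg, neg_zero]⟩
  have h1 (i : Fin 2) := measurePreserving_pi (fun _ : Fin (S.J i) => _) (fun _ => _)
    (fun _ : Fin (S.J i) => h i)
  have h2 := measurePreserving_pi (fun i : Fin 2 => _) (fun i => _) (fun i => h1 i)
  exact measurePreserving_pi (fun _ : Fin n => _) (fun _ => _) (fun _ : Fin n => h2)

/-- The power of the legitimate part of what is sent in use `k`. -/
noncomputable def JammingScheme.signalPower (k : Fin n) (w : c.Source) : ℝ :=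
  ∑ i, ∑ a, (S.VL i *ᵥ (w i).2 k) a ^ 2

lemma signalPower_nonneg (k : Fin n) (w : c.Source) : 0 ≤ S.signalPower c k w := by
  unfold JammingScheme.signalPower; positivity

lemma measurable_signalPower (k : Fin n) : Measurable (S.signalPower c k) := by
  unfold JammingScheme.signalPower
  simp only [mulVec, dotProduct]
  fun_prop

/-- The jamming law is symmetric, so `r` may be averaged with `-r`; the cross terms cancel pointwise
by the parallelogram law. No integrability of the signal has to be known beforehand. -/
lemma lintegral_signalPower_le {P : ℝ} (hc : S.PowerConstraint P c) :
    ∫⁻ w, ENNReal.ofReal (∑ k, S.signalPower c k w) ∂c.sourceLaw ≤ ENNReal.ofReal (n * P) := by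
  refine le_trans ?_ hc
  have hm : Measurable fun ω : c.Source × Jam S.J n =>
      ∑ k, ∑ i, ∑ a, (S.sent c ω.1 ω.2 k i a) ^ 2 := by
    simp only [JammingScheme.sent, Pi.add_apply, mulVec, dotProduct]
    fun_prop
  rw [lintegral_prod _ hm.ennreal_ofReal.aemeasurable]
  refine lintegral_mono fun w => ?_
  refine ofReal_le_lintegral_of_symmetric (measurePreserving_neg_jamLaw S P)
    (hm.comp measurable_prodMk_left) (fun r => by dsimp only [Function.comp]; positivity) fun r => ?_
  simp only [Function.comp_apply, JammingScheme.signalPower]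
  rw [Finset.mul_sum, ← Finset.sum_add_distrib]
  refine Finset.sum_le_sum fun k _ => ?_
  rw [Finset.mul_sum, ← Finset.sum_add_distrib]
  refine Finset.sum_le_sum fun i _ => ?_
  rw [Finset.mul_sum, ← Finset.sum_add_distrib]
  refine Finset.sum_le_sum fun a _ => ?_
  have : S.sent c w (-r) k i a = (S.VL i *ᵥ (w i).2 k) a - (S.VJ i *ᵥ r k i) a := by
    simp [JammingScheme.sent, mulVec_neg, sub_eq_add_neg]
  rw [this, JammingScheme.sent, Pi.add_apply]
  nlinarith [sq_nonneg ((S.VJ i *ᵥ r k i) a)]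

lemma integrable_signalPower {P : ℝ} (hc : S.PowerConstraint P c) (k : Fin n) :
    Integrable (S.signalPower c k) c.sourceLaw := by
  refine (lintegral_ofReal_ne_top_iff_integrable (measurable_signalPower S c k).aestronglyMeasurable
    (.of_forall (signalPower_nonneg S c k))).mp ?_
  refine ne_top_of_le_ne_top ENNReal.ofReal_ne_top
    (le_trans (lintegral_mono fun w => ENNReal.ofReal_le_ofReal ?_) (lintegral_signalPower_le S c hc))
  exact Finset.single_le_sum (f := fun k => S.signalPower c k w)
    (fun k _ => signalPower_nonneg S c k w) (Finset.mem_univ k)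

lemma sum_integral_signalPower_le {P : ℝ} (hP : 0 ≤ P) (hc : S.PowerConstraint P c) :
    ∑ k, ∫ w, S.signalPower c k w ∂c.sourceLaw ≤ n * P := by
  rw [← integral_finsetSum _ fun k _ => integrable_signalPower S c hc k,
    integral_eq_lintegral_of_nonneg_ae
      (.of_forall fun w => Finset.sum_nonneg fun k _ => signalPower_nonneg S c k w)
      (Finset.measurable_sum _ fun k _ => measurable_signalPower S c k).aestronglyMeasurable]
  exact ENNReal.toReal_le_of_le_ofReal (by positivity) (lintegral_signalPower_le S c hc)

variable (g : Fin n → Channel M N_e)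

/-- Cauchy-Schwarz at each receive antenna, over the antennas of both transmitters jointly. -/
lemma sum_sq_receivedSignal_le (k : Fin n) (w : c.Source) :
    ∑ a, S.receivedSignal c g w k a ^ 2 ≤ gain (g k) * S.signalPower c k w := by
  have hgain : gain (g k) = ∑ a, ∑ i, ∑ m, g k i a m ^ 2 := Finset.sum_comm
  rw [hgain, Finset.sum_mul]
  refine Finset.sum_le_sum fun a _ => ?_
  have h1 : S.receivedSignal c g w k a =
      ∑ σ : Σ i, Fin (M i), g k σ.1 a σ.2 * (S.VL σ.1 *ᵥ (w σ.1).2 k) σ.2 := by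
    rw [Fintype.sum_sigma]
    simp only [JammingScheme.receivedSignal, ← mulVec_mulVec, Finset.sum_apply]
    rfl
  have h2 := Finset.sum_mul_sq_le_sq_mul_sq Finset.univ
    (fun σ : Σ i, Fin (M i) => g k σ.1 a σ.2) (fun σ => (S.VL σ.1 *ᵥ (w σ.1).2 k) σ.2)
  rw [← h1, Fintype.sum_sigma, Fintype.sum_sigma] at h2
  exact h2

lemma memLp_receivedSignal {P : ℝ} (hc : S.PowerConstraint P c) (k : Fin n) (a : Fin N_e) :
    MemLp (fun w => S.receivedSignal c g w k a) 2 c.sourceLaw := by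
  have hm := measurable_receivedSignal S c g k a
  refine (memLp_two_iff_integrable_sq hm.aestronglyMeasurable).mpr ?_
  refine ((integrable_signalPower S c hc k).const_mul (gain (g k))).mono'
    (by fun_prop) (.of_forall fun w => ?_)
  rw [Real.norm_eq_abs, abs_of_nonneg (sq_nonneg _)]
  refine le_trans ?_ (sum_sq_receivedSignal_le S c g k w)
  exact Finset.single_le_sum (f := fun a => S.receivedSignal c g w k a ^ 2)
    (fun _ _ => sq_nonneg _) (Finset.mem_univ a)

end Power

/-! ### Bound on the log-determinant, uniform in the code -/

section RateBound

variable {M : Fin 2 → ℕ} {N_E N_e n : ℕ}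

/-- A channel function that bounds the signal-to-interference ratio, for all powers. -/
noncomputable def interferenceRatio (D : Channel M N_e → ℝ) (c₀ : ℝ) (q : ℕ) (h : Channel M N_e) :
    ℝ :=
  c₀ * (1 + gain h) ^ (q + 1) / D h ^ 2

/-- A bound for the rate of the eavesdropper in one channel use, with transmit power `P`. -/
noncomputable def rateBound (σ2 : ℝ≥0) (D : Channel M N_e → ℝ) (c₀ : ℝ) (q : ℕ) (P : ℝ)
    (h : Channel M N_e) : ℝ :=
  N_e / 2 * (Real.log (1 + min (interferenceRatio D c₀ q h) ((1 + gain h) * P / σ2)) + 1)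

lemma interferenceRatio_nonneg (D : Channel M N_e → ℝ) {c₀ : ℝ} (hc₀ : 0 ≤ c₀) (q : ℕ)
    (h : Channel M N_e) : 0 ≤ interferenceRatio D c₀ q h := by
  have := gain_nonneg h
  unfold interferenceRatio; positivity

/-- Separates the channel factor `x` from the power fraction `p` of one use. A code may concentrate
its power on few uses; the fractions now enter additively and only their sum counts. -/
lemma log_one_add_mul_le {x p : ℝ} (hx : 0 ≤ x) (hp : 0 ≤ p) :
    Real.log (1 + x * p) ≤ Real.log (1 + x) + p := by
  calc Real.log (1 + x * p) ≤ Real.log ((1 + x) * (1 + p)) :=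
        Real.log_le_log (by positivity) (by nlinarith)
    _ = Real.log (1 + x) + Real.log (1 + p) := Real.log_mul (by positivity) (by positivity)
    _ ≤ Real.log (1 + x) + p := by
        have := Real.log_le_sub_one_of_pos (show 0 < 1 + p by positivity)
        linarith

variable (S : JammingScheme M N_E) {σ2 : ℝ≥0} {D : Channel M N_e → ℝ} {c₀ : ℝ} {q : ℕ}

lemma dotProduct_noise_add_jamCov_mulVec (σ2 : ℝ≥0) (P : ℝ) (h : Channel M N_e)
    (t : Fin N_e → ℝ) :
    t ⬝ᵥ ((σ2 : ℝ) • (1 : Matrix (Fin N_e) (Fin N_e) ℝ) + S.jamCov P h) *ᵥ t =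
      σ2 * ∑ a, t a ^ 2 +
        P * ∑ i, S.α i / S.J i * ∑ j, ((Matrix.of (h i) * S.VJ i)ᵀ *ᵥ t) j ^ 2 := by
  rw [add_mulVec, dotProduct_add, smul_mulVec, one_mulVec, dotProduct_smul, JammingScheme.jamCov,
    sum_mulVec, dotProduct_sum]
  congr 1
  · simp [dotProduct, sq]
  · rw [Finset.mul_sum]
    refine Finset.sum_congr rfl fun i _ => ?_
    rw [smul_mulVec, dotProduct_smul, ← mulVec_mulVec, dotProduct_mulVec, ← mulVec_transpose,
      JammingScheme.jamPower, smul_eq_mul]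
    have : ∀ y : Fin (S.J i) → ℝ, y ⬝ᵥ y = ∑ j, y j ^ 2 := fun y => by simp [dotProduct, sq]
    rw [this]
    ring

/-- The quadratic form of `t` is 1 and splits into a noise part and a jamming part, so each is at
most 1. The jamming part gives the first entry of the minimum, free of `P`; the noise part gives the
second, free of `D`. -/
lemma whitened_row_le (hσ : 0 < σ2) (hc₀ : 0 ≤ c₀)
    (hD : ∀ (h : Channel M N_e) (t : Fin N_e → ℝ), D h ^ 2 * ∑ a, t a ^ 2 ≤
      c₀ * (1 + gain h) ^ q *
        ∑ i, S.α i / S.J i * ∑ j, ((Matrix.of (h i) * S.VJ i)ᵀ *ᵥ t) j ^ 2)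
    {P : ℝ} (hP : 0 < P) {h : Channel M N_e} (hDh : D h ≠ 0)
    {t : Fin N_e → ℝ}
    (ht : t ⬝ᵥ ((σ2 : ℝ) • (1 : Matrix (Fin N_e) (Fin N_e) ℝ) + S.jamCov P h) *ᵥ t = 1) :
    (∑ a, t a ^ 2) * gain h * P ≤
      min (interferenceRatio D c₀ q h) ((1 + gain h) * P / σ2) := by
  rw [dotProduct_noise_add_jamCov_mulVec] at ht
  have hg := gain_nonneg h
  have hσ' : (0 : ℝ) < σ2 := by exact_mod_cast hσ
  have ht0 : 0 ≤ ∑ a, t a ^ 2 := by positivity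
  set s := ∑ i, S.α i / S.J i * ∑ j, ((Matrix.of (h i) * S.VJ i)ᵀ *ᵥ t) j ^ 2
  have hs0 : 0 ≤ s := Finset.sum_nonneg fun i _ => by
    have := (S.α_pos i).le
    positivity
  have hDt := hD h t
  have hD2 : 0 < D h ^ 2 := by positivity
  have h1 : P * s ≤ 1 := by nlinarith
  have h2 : σ2 * ∑ a, t a ^ 2 ≤ 1 := by nlinarith
  refine le_min ?_ ?_
  · rw [interferenceRatio, le_div_iff₀ hD2]
    calc (∑ a, t a ^ 2) * gain h * P * D h ^ 2 = (D h ^ 2 * ∑ a, t a ^ 2) * (gain h * P) := by ring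
      _ ≤ (c₀ * (1 + gain h) ^ q * s) * (gain h * P) := by gcongr
      _ = c₀ * (1 + gain h) ^ q * gain h * (P * s) := by ring
      _ ≤ c₀ * (1 + gain h) ^ q * (1 + gain h) * 1 := by
          gcongr
          linarith
      _ = c₀ * (1 + gain h) ^ (q + 1) := by ring
  · rw [le_div_iff₀ hσ']
    calc (∑ a, t a ^ 2) * gain h * P * σ2 = (σ2 * ∑ a, t a ^ 2) * (gain h * P) := by ring
      _ ≤ 1 * ((1 + gain h) * P) := by
          gcongr
          linarith
      _ = (1 + gain h) * P := one_mul _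

/-- The information about the source is at most the log-det bound, which is at most the mean
of `rateBound` over the block. -/
lemma mutualInfo_source_le_logDetBound (hσ : 0 < σ2) (hc₀ : 0 ≤ c₀)
    (hD : ∀ (h : Channel M N_e) (t : Fin N_e → ℝ), D h ^ 2 * ∑ a, t a ^ 2 ≤
      c₀ * (1 + gain h) ^ q *
        ∑ i, S.α i / S.J i * ∑ j, ((Matrix.of (h i) * S.VJ i)ᵀ *ᵥ t) j ^ 2)
    {P : ℝ} (hP : 0 < P) (hn : 0 < n) (c : Code S.L n)
    (hc : S.PowerConstraint P c) (g : Fin n → Channel M N_e) (hg : ∀ k, D (g k) ≠ 0) :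
    mutualInfo (S.law σ2 N_e P c) Prod.fst (S.received c g) ≤
      ENNReal.ofReal (n * S.logDetBound σ2 P c g) ∧
    S.logDetBound σ2 P c g ≤ (∑ k, rateBound σ2 D c₀ q P (g k)) / n := by
  have hu := memLp_receivedSignal S c g hc
  have hSig : ∀ k, (S.signalCov c g k).PosSemidef := fun k => by
    rw [signalCov_eq]
    exact posSemidef_secondMoment _ (hu k)
  choose T d hd hT hTS using fun k =>
    exists_whitening (posDef_noise_add_jamCov S hP.le hσ (g k)) (hSig k)
  have hn' : (0 : ℝ) < n := by exact_mod_cast hn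
  have hlogdet : S.logDetBound σ2 P c g = (∑ k, ∑ a, 1 / 2 * Real.log (1 + d k a)) / n := by
    rw [JammingScheme.logDetBound]
    congr 1
    refine Finset.sum_congr rfl fun k _ => ?_
    rw [add_right_comm, det_add_div_det (hT k) (hTS k),
      Real.log_prod fun a _ => by linarith [hd k a], Finset.mul_sum]
  constructor
  · rw [hlogdet, mul_div_cancel₀ _ hn'.ne']
    exact mutualInfo_source_le S c g hP.le σ2 hu hd hT hTS
  rw [hlogdet]
  gcongr ?_ / _
  -- Signal power of use `k` relative to `P`. One fraction may be large, but their sum is at most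
  -- `n`; this yields the summand 1 in `rateBound`.
  set p : Fin n → ℝ := fun k => (∫ w, S.signalPower c k w ∂c.sourceLaw) / P with hp
  have hp0 : ∀ k, 0 ≤ p k := fun k =>
    div_nonneg (integral_nonneg fun w => signalPower_nonneg S c k w) hP.le
  have hpn : ∑ k, p k ≤ n := by
    rw [← Finset.sum_div, div_le_iff₀ hP]
    exact sum_integral_signalPower_le S c hP.le hc
  set x : Fin n → ℝ := fun k =>
    min (interferenceRatio D c₀ q (g k)) ((1 + gain (g k)) * P / σ2) with hx
  have hx0 : ∀ k, 0 ≤ x k := fun k => by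
    have := gain_nonneg (g k)
    exact le_min (interferenceRatio_nonneg D hc₀ q _) (by positivity)
  have hdx : ∀ k a, d k a ≤ x k * p k := by
    intro k a
    have h1 : T k a ⬝ᵥ S.signalCov c g k *ᵥ T k a = d k a := by
      have h2 : (T k * S.signalCov c g k * (T k)ᵀ) a a = d k a := by rw [hTS]; simp
      rw [← h2, Matrix.mul_assoc]
      rfl
    have h3 : T k a ⬝ᵥ ((σ2 : ℝ) • (1 : Matrix (Fin N_e) (Fin N_e) ℝ) + S.jamCov P (g k)) *ᵥ T k a
        = 1 := by
      have h2 : (T k * ((σ2 : ℝ) • (1 : Matrix (Fin N_e) (Fin N_e) ℝ) + S.jamCov P (g k)) *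
        (T k)ᵀ) a a = 1 := by rw [hT]; simp
      rw [← h2, Matrix.mul_assoc]
      rfl
    rw [← h1, signalCov_eq, dotProduct_secondMoment_mulVec _ (hu k)]
    calc ∫ w, (T k a ⬝ᵥ S.receivedSignal c g w k) * (T k a ⬝ᵥ S.receivedSignal c g w k)
          ∂c.sourceLaw
        ≤ ∫ w, (∑ b, T k a b ^ 2) * gain (g k) * S.signalPower c k w ∂c.sourceLaw := by
          refine integral_mono_of_nonneg (.of_forall fun w => mul_self_nonneg _)
            ((integrable_signalPower S c hc k).const_mul _) (.of_forall fun w => ?_)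
          dsimp only
          rw [← sq, mul_assoc]
          refine (Finset.sum_mul_sq_le_sq_mul_sq _ _ _).trans ?_
          exact mul_le_mul_of_nonneg_left (sum_sq_receivedSignal_le S c g k w) (by positivity)
      _ = (∑ b, T k a b ^ 2) * gain (g k) * P * p k := by
          rw [integral_const_mul, hp]
          field_simp
      _ ≤ x k * p k := mul_le_mul_of_nonneg_right
          (whitened_row_le S hσ hc₀ hD hP (hg k) h3) (hp0 k)
  calc ∑ k, ∑ a, 1 / 2 * Real.log (1 + d k a)
      ≤ ∑ k, ∑ _a : Fin N_e, 1 / 2 * (Real.log (1 + x k) + p k) := by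
        refine Finset.sum_le_sum fun k _ => Finset.sum_le_sum fun a _ => ?_
        have h1 : Real.log (1 + d k a) ≤ Real.log (1 + x k * p k) :=
          Real.log_le_log (by linarith [hd k a]) (by linarith [hdx k a])
        have h2 := log_one_add_mul_le (hx0 k) (hp0 k)
        linarith
    _ = ∑ k, N_e / 2 * Real.log (1 + x k) + N_e / 2 * ∑ k, p k := by
        simp only [Finset.sum_const, Finset.card_univ, Fintype.card_fin, nsmul_eq_mul]
        rw [Finset.mul_sum, ← Finset.sum_add_distrib]
        exact Finset.sum_congr rfl fun k _ => by ring
    _ ≤ ∑ k, N_e / 2 * Real.log (1 + x k) + N_e / 2 * n := by gcongr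
    _ = ∑ k, rateBound σ2 D c₀ q P (g k) := by
        simp only [rateBound, mul_add, Finset.sum_add_distrib, mul_one, Finset.sum_const,
          Finset.card_univ, Fintype.card_fin, nsmul_eq_mul]
        ring

end RateBound

end Wiretap

namespace Wiretap

/-! ### Averaging the bound over the channel -/

section MeanRateBound

variable {M : Fin 2 → ℕ} {N_E N_e n : ℕ} {σ2 : ℝ≥0} {D : Channel M N_e → ℝ} {c₀ : ℝ} {q : ℕ}

lemma measurable_rateBound (hDm : Measurable D) (P : ℝ) :
    Measurable (rateBound σ2 D c₀ q P) := by
  have := measurable_gain (M := M) (N_e := N_e)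
  unfold rateBound interferenceRatio
  fun_prop

lemma rateBound_le_of_interferenceRatio (hc₀ : 0 ≤ c₀) {P : ℝ} (hP : 0 ≤ P) (h : Channel M N_e) :
    rateBound σ2 D c₀ q P h ≤ N_e / 2 * (Real.log (1 + interferenceRatio D c₀ q h) + 1) := by
  have h1 := interferenceRatio_nonneg D hc₀ q h
  have h2 := gain_nonneg h
  have h3 : 0 ≤ (1 + gain h) * P / σ2 := by positivity
  have h4 : 0 ≤ min (interferenceRatio D c₀ q h) ((1 + gain h) * P / σ2) := le_min h1 h3
  unfold rateBound
  gcongr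
  exact min_le_left _ _

/-- The noise branch of the minimum: it grows like `log P`, but is integrable over the channel
without any condition on `D`. -/
lemma rateBound_le_of_one_le (hc₀ : 0 ≤ c₀) {P : ℝ} (hP : 1 ≤ P) (h : Channel M N_e) :
    rateBound σ2 D c₀ q P h ≤
      N_e / 2 * (gain h + Real.log P + Real.log (1 + 1 / σ2) + 1) := by
  have h1 := interferenceRatio_nonneg D hc₀ q h
  have h2 := gain_nonneg h
  have h3 : 0 ≤ (1 + gain h) * P / σ2 := by positivity
  have h4 : 0 ≤ min (interferenceRatio D c₀ q h) ((1 + gain h) * P / σ2) := le_min h1 h3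
  have h5 : Real.log (1 + min (interferenceRatio D c₀ q h) ((1 + gain h) * P / σ2)) ≤
      Real.log ((1 + gain h) * P * (1 + 1 / σ2)) := by
    refine Real.log_le_log (by linarith) ?_
    have h6 := min_le_right (interferenceRatio D c₀ q h) ((1 + gain h) * P / σ2)
    have h7 : (1 + gain h) * P * (1 + 1 / σ2) = (1 + gain h) * P + (1 + gain h) * P / σ2 := by ring
    nlinarith
  rw [Real.log_mul (by positivity) (by positivity), Real.log_mul (by positivity) (by positivity)]
    at h5
  have h8 := Real.log_le_sub_one_of_pos (show 0 < 1 + gain h by positivity)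
  unfold rateBound
  gcongr
  linarith

lemma lintegral_gain_ne_top (ν : Measure ℝ) [IsProbabilityMeasure ν] (hν : MemLp id 2 ν) :
    ∫⁻ h : Channel M N_e, ENNReal.ofReal (gain h) ∂(channelUseLaw M N_e ν) ≠ ∞ := by
  have hent (i : Fin 2) (a : Fin N_e) (m : Fin (M i)) :
      MeasurePreserving (fun h : Channel M N_e => h i a m) (channelUseLaw M N_e ν) ν :=
    (measurePreserving_eval (fun _ : Fin (M i) => ν) m).comp
      ((measurePreserving_eval (fun _ : Fin N_e => Measure.pi fun _ : Fin (M i) => ν) a).comp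
        (measurePreserving_eval (fun i : Fin 2 => Measure.pi fun _ : Fin N_e =>
          Measure.pi fun _ : Fin (M i) => ν) i))
  have hsq : Integrable (fun x : ℝ => x ^ 2) ν := hν.integrable_sq
  have hint : Integrable (gain : Channel M N_e → ℝ) (channelUseLaw M N_e ν) := by
    unfold gain
    exact integrable_finsetSum _ fun i _ => integrable_finsetSum _ fun a _ =>
      integrable_finsetSum _ fun m _ => (hent i a m).integrable_comp_of_integrable hsq
  exact hint.lintegral_lt_top.ne

/-- The mean of `rateBound` over the channel of one use. -/
noncomputable def meanRateBound (σ2 : ℝ≥0) (D : Channel M N_e → ℝ) (c₀ : ℝ) (q : ℕ)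
    (ν : Measure ℝ) (P : ℝ) : ℝ≥0∞ :=
  ∫⁻ h, ENNReal.ofReal (rateBound σ2 D c₀ q P h) ∂(channelUseLaw M N_e ν)

/-- The logarithm turns the quotient into a sum of integrable terms: the gain has finite mean, and
the last term is the negative part of `log |D h|`. -/
lemma log_one_add_interferenceRatio_le (hc₀ : 0 ≤ c₀) {h : Channel M N_e} (hD : D h ≠ 0) :
    Real.log (1 + interferenceRatio D c₀ q h) ≤
      Real.log (1 + c₀) + (q + 1) * gain h + Real.log 2 + 2 * max (-Real.log (D h)) 0 := by
  have hg := gain_nonneg h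
  have hD2 : 0 < D h ^ 2 := by positivity
  have hB : 1 ≤ (1 + gain h) ^ (q + 1) := one_le_pow₀ (by linarith)
  have h1 : 1 + interferenceRatio D c₀ q h ≤
      (1 + c₀) * (1 + gain h) ^ (q + 1) * (1 + 1 / D h ^ 2) := by
    have h2 : interferenceRatio D c₀ q h = c₀ * (1 + gain h) ^ (q + 1) * (1 / D h ^ 2) := by
      rw [interferenceRatio]; ring
    rw [h2]
    have h3 : 0 < 1 / D h ^ 2 := by positivity
    have h4 : 0 ≤ c₀ * (1 + gain h) ^ (q + 1) := by positivity
    nlinarith [mul_pos (lt_of_lt_of_le one_pos hB) h3]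
  have h2 : Real.log (1 + 1 / D h ^ 2) ≤ Real.log 2 + 2 * max (-Real.log (D h)) 0 := by
    rcases le_total 1 (D h ^ 2) with hle | hle
    · have : Real.log (1 + 1 / D h ^ 2) ≤ Real.log 2 := by
        refine Real.log_le_log (by positivity) ?_
        have := (div_le_one hD2).mpr hle
        linarith
      linarith [le_max_right (-Real.log (D h)) 0]
    · have h3 : Real.log (1 + 1 / D h ^ 2) ≤ Real.log (2 * (D h ^ 2)⁻¹) := by
        refine Real.log_le_log (by positivity) ?_
        have := (one_le_inv₀ hD2).mpr hle
        rw [one_div]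
        linarith
      rw [Real.log_mul two_ne_zero (by positivity), Real.log_inv, Real.log_pow] at h3
      push_cast at h3
      linarith [le_max_left (-Real.log (D h)) 0]
  have h0 := interferenceRatio_nonneg D hc₀ q h
  calc Real.log (1 + interferenceRatio D c₀ q h)
      ≤ Real.log ((1 + c₀) * (1 + gain h) ^ (q + 1) * (1 + 1 / D h ^ 2)) :=
        Real.log_le_log (by linarith) h1
    _ = Real.log (1 + c₀) + (q + 1) * Real.log (1 + gain h) + Real.log (1 + 1 / D h ^ 2) := by
        rw [Real.log_mul (by positivity) (by positivity),
          Real.log_mul (by positivity) (by positivity), Real.log_pow]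
        push_cast
        ring
    _ ≤ _ := by
        have h8 := Real.log_le_sub_one_of_pos (show 0 < 1 + gain h by positivity)
        have h9 : (q + 1 : ℝ) * Real.log (1 + gain h) ≤ (q + 1) * gain h := by
          gcongr
          linarith
        linarith

variable (ν : Measure ℝ) [IsProbabilityMeasure ν]

/-- If the determinant of the received jamming is log-integrable, then the mean of `rateBound` is
bounded in the power. -/
lemma exists_meanRateBound_le (hν : MemLp id 2 ν) (hc₀ : 0 ≤ c₀)
    (hD : ∀ᵐ h ∂(channelUseLaw M N_e ν), D h ≠ 0)
    (hlog : ∫⁻ h, ENNReal.ofReal (-Real.log (D h)) ∂(channelUseLaw M N_e ν) ≠ ∞) :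
    ∃ C : ℝ≥0, ∀ P : ℝ, 0 < P → meanRateBound σ2 D c₀ q ν P ≤ C := by
  set B : ℝ≥0∞ := ∫⁻ h, (ENNReal.ofReal (N_e / 2 * (Real.log (1 + c₀) + Real.log 2 + 1)) +
    ENNReal.ofReal (N_e / 2 * (q + 1)) * ENNReal.ofReal (gain h) +
    N_e * ENNReal.ofReal (-Real.log (D h))) ∂(channelUseLaw M N_e ν) with hB
  have hBtop : B ≠ ∞ := by
    have hgm := (measurable_gain (M := M) (N_e := N_e)).ennreal_ofReal
    rw [hB, lintegral_add_left (by fun_prop), lintegral_add_left (by fun_prop),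
      lintegral_const_mul' _ _ ENNReal.ofReal_ne_top,
      lintegral_const_mul' _ _ (ENNReal.natCast_ne_top _), lintegral_const, measure_univ]
    refine ENNReal.add_ne_top.mpr ⟨ENNReal.add_ne_top.mpr ⟨by simp, ?_⟩, ?_⟩
    · exact ENNReal.mul_ne_top ENNReal.ofReal_ne_top (lintegral_gain_ne_top ν hν)
    · exact ENNReal.mul_ne_top (ENNReal.natCast_ne_top _) hlog
  refine ⟨B.toNNReal, fun P hP => ?_⟩
  rw [ENNReal.coe_toNNReal hBtop]
  refine lintegral_mono_ae ?_
  filter_upwards [hD] with h hh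
  have h1 := rateBound_le_of_interferenceRatio (σ2 := σ2) (D := D) (q := q) hc₀ hP.le h
  have h2 := log_one_add_interferenceRatio_le (q := q) hc₀ hh
  have hg := gain_nonneg h
  have h3 : rateBound σ2 D c₀ q P h ≤ N_e / 2 * (Real.log (1 + c₀) + Real.log 2 + 1) +
      N_e / 2 * (q + 1) * gain h + N_e * max (-Real.log (D h)) 0 := by
    refine h1.trans ?_
    have : (N_e : ℝ) / 2 * (Real.log (1 + interferenceRatio D c₀ q h) + 1) ≤ N_e / 2 *
        (Real.log (1 + c₀) + (q + 1) * gain h + Real.log 2 + 2 * max (-Real.log (D h)) 0 + 1) := by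
      gcongr
    linarith
  have hlog0 : 0 ≤ Real.log (1 + c₀) := Real.log_nonneg (by linarith)
  have hlog2 : 0 ≤ Real.log 2 := Real.log_nonneg (by norm_num)
  refine (ENNReal.ofReal_le_ofReal h3).trans (le_of_eq ?_)
  have hmax : ENNReal.ofReal (max (-Real.log (D h)) 0) = ENNReal.ofReal (-Real.log (D h)) := by
    rw [ENNReal.ofReal_max, ENNReal.ofReal_zero, max_eq_left zero_le]
  rw [ENNReal.ofReal_add (by positivity) (by positivity),
    ENNReal.ofReal_add (by positivity) (by positivity),
    ENNReal.ofReal_mul (p := (N_e : ℝ) / 2 * (q + 1)) (by positivity),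
    ENNReal.ofReal_mul (p := (N_e : ℝ)) (by positivity), ENNReal.ofReal_natCast, hmax]

lemma tendsto_ofReal_half_log :
    Tendsto (fun P : ℝ => ENNReal.ofReal (1 / 2 * Real.log P)) atTop (𝓝 ∞) :=
  ENNReal.tendsto_ofReal_atTop.comp (Real.tendsto_log_atTop.const_mul_atTop (by norm_num))

lemma tendsto_const_div_half_log {a : ℝ≥0∞} (ha : a ≠ ∞) :
    Tendsto (fun P : ℝ => a / ENNReal.ofReal (1 / 2 * Real.log P)) atTop (𝓝 0) := by
  have := ENNReal.Tendsto.const_div tendsto_ofReal_half_log (a := a) (.inr ha)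
  rwa [ENNReal.div_top] at this

/-- For each channel the numerator is bounded in `P` by the jamming branch, so the quotient tends to
0. The noise branch divided by `log P` is dominated by an affine function of the gain, which has
finite mean. -/
lemma tendsto_meanRateBound_div (hν : MemLp id 2 ν) (hDm : Measurable D) (hc₀ : 0 ≤ c₀) :
    Tendsto (fun P : ℝ => meanRateBound σ2 D c₀ q ν P / ENNReal.ofReal (1 / 2 * Real.log P))
      atTop (𝓝 0) := by
  have hlogσ : 0 ≤ Real.log (1 + 1 / (σ2 : ℝ)) :=
    Real.log_nonneg (le_add_of_nonneg_right (by positivity))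
  have key : Tendsto (fun P : ℝ => ∫⁻ h, ENNReal.ofReal (rateBound σ2 D c₀ q P h) *
      (ENNReal.ofReal (1 / 2 * Real.log P))⁻¹ ∂(channelUseLaw M N_e ν)) atTop
      (𝓝 (∫⁻ _, 0 ∂(channelUseLaw M N_e ν))) := by
    refine tendsto_lintegral_filter_of_dominated_convergence (fun h => ENNReal.ofReal N_e *
      (ENNReal.ofReal (gain h) + ENNReal.ofReal (Real.log (1 + 1 / (σ2 : ℝ)) + 2))) ?_ ?_ ?_ ?_
    · exact .of_forall fun P => (measurable_rateBound hDm P).ennreal_ofReal.mul_const _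
    · filter_upwards [eventually_ge_atTop (Real.exp 1)] with P hP
      have hP1 : 1 ≤ P := (Real.one_le_exp zero_le_one).trans hP
      have hlogP : 1 ≤ Real.log P := by
        rw [← Real.log_exp 1]
        exact Real.log_le_log (Real.exp_pos 1) hP
      refine .of_forall fun h => ?_
      have hg := gain_nonneg h
      rw [← ENNReal.div_eq_inv_mul.trans (mul_comm _ _), ← ENNReal.ofReal_div_of_pos (by linarith),
        ← ENNReal.ofReal_add hg (by positivity), ← ENNReal.ofReal_mul (by positivity)]
      refine ENNReal.ofReal_le_ofReal ?_
      rw [div_le_iff₀ (by linarith)]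
      refine (rateBound_le_of_one_le hc₀ hP1 h).trans ?_
      have : gain h + Real.log P + Real.log (1 + 1 / σ2) + 1 ≤
          (gain h + (Real.log (1 + 1 / (σ2 : ℝ)) + 2)) * Real.log P := by nlinarith
      calc (N_e : ℝ) / 2 * (gain h + Real.log P + Real.log (1 + 1 / σ2) + 1)
          ≤ N_e / 2 * ((gain h + (Real.log (1 + 1 / (σ2 : ℝ)) + 2)) * Real.log P) := by gcongr
        _ = _ := by ring
    · have hgm := (measurable_gain (M := M) (N_e := N_e)).ennreal_ofReal
      rw [lintegral_const_mul' _ _ ENNReal.ofReal_ne_top, lintegral_add_left hgm, lintegral_const,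
        measure_univ, mul_one]
      exact ENNReal.mul_ne_top ENNReal.ofReal_ne_top
        (ENNReal.add_ne_top.mpr ⟨lintegral_gain_ne_top ν hν, ENNReal.ofReal_ne_top⟩)
    · refine .of_forall fun h => ?_
      refine tendsto_of_tendsto_of_tendsto_of_le_of_le' tendsto_const_nhds
        (tendsto_const_div_half_log (a := ENNReal.ofReal
          (N_e / 2 * (Real.log (1 + interferenceRatio D c₀ q h) + 1))) ENNReal.ofReal_ne_top)
        (.of_forall fun _ => zero_le) ?_
      filter_upwards [eventually_ge_atTop 0] with P hP
      rw [div_eq_mul_inv]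
      exact mul_le_mul' (ENNReal.ofReal_le_ofReal (rateBound_le_of_interferenceRatio hc₀ hP h)) le_rfl
  rw [lintegral_zero] at key
  refine key.congr fun P => ?_
  rw [lintegral_mul_const _ (measurable_rateBound hDm P).ennreal_ofReal, meanRateBound]
  exact (div_eq_mul_inv _ _).symm

lemma meanRateBound_ne_top (hν : MemLp id 2 ν) (hc₀ : 0 ≤ c₀) {P : ℝ} (hP : 1 ≤ P) :
    meanRateBound σ2 D c₀ q ν P ≠ ∞ := by
  have hgm := (measurable_gain (M := M) (N_e := N_e)).ennreal_ofReal
  have hlogσ : 0 ≤ Real.log (1 + 1 / (σ2 : ℝ)) :=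
    Real.log_nonneg (le_add_of_nonneg_right (by positivity))
  have hlogP := Real.log_nonneg hP
  refine ne_top_of_le_ne_top (b := ∫⁻ h : Channel M N_e, ENNReal.ofReal (N_e / 2) *
    (ENNReal.ofReal (gain h) + ENNReal.ofReal (Real.log P + Real.log (1 + 1 / σ2) + 1))
    ∂(channelUseLaw M N_e ν)) ?_ (lintegral_mono fun h => ?_)
  · rw [lintegral_const_mul' _ _ ENNReal.ofReal_ne_top, lintegral_add_left hgm, lintegral_const,
      measure_univ, mul_one]
    exact ENNReal.mul_ne_top ENNReal.ofReal_ne_top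
      (ENNReal.add_ne_top.mpr ⟨lintegral_gain_ne_top ν hν, ENNReal.ofReal_ne_top⟩)
  · rw [← ENNReal.ofReal_add (gain_nonneg h) (by positivity), ← ENNReal.ofReal_mul (by positivity)]
    refine ENNReal.ofReal_le_ofReal ((rateBound_le_of_one_le hc₀ hP h).trans (le_of_eq ?_))
    ring

end MeanRateBound

end Wiretap

namespace Wiretap

/-! ### The channel as part of the observation -/

section RandomChannel

variable {M : Fin 2 → ℕ} {N_E N_e n : ℕ} (S : JammingScheme M N_E) {σ2 : ℝ≥0}
  {D : Channel M N_e → ℝ} {c₀ : ℝ} {q : ℕ} (ν : Measure ℝ) [IsProbabilityMeasure ν]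

/-- The information about the source, for the random channel. -/
lemma mutualInfo_source_random_le (hσ : 0 < σ2) (hc₀ : 0 ≤ c₀)
    (hD : ∀ (h : Channel M N_e) (t : Fin N_e → ℝ), D h ^ 2 * ∑ a, t a ^ 2 ≤
      c₀ * (1 + gain h) ^ q *
        ∑ i, S.α i / S.J i * ∑ j, ((Matrix.of (h i) * S.VJ i).transpose.mulVec t) j ^ 2)
    (hDm : Measurable D) (hD0 : ∀ᵐ h ∂(channelUseLaw M N_e ν), D h ≠ 0) {P : ℝ} (hP : 0 < P)
    (hn : 0 < n) (c : Code S.L n) (hc : S.PowerConstraint P c) :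
    mutualInfo ((S.law σ2 N_e P c).prod (channelLaw M N_e n ν)) (fun ω => ω.1.1)
      (fun ω => (S.received c ω.2 ω.1, ω.2)) ≤ n * meanRateBound σ2 D c₀ q ν P := by
  have hev (k : Fin n) : MeasurePreserving (fun g : Fin n → Channel M N_e => g k)
      (channelLaw M N_e n ν) (channelUseLaw M N_e ν) :=
    measurePreserving_eval (fun _ : Fin n => channelUseLaw M N_e ν) k
  have hae : ∀ᵐ g ∂(channelLaw M N_e n ν), ∀ k, D (g k) ≠ 0 :=
    ae_all_iff.mpr fun k => (hev k).quasiMeasurePreserving.ae hD0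
  have hn' : (0 : ℝ) < n := by exact_mod_cast hn
  have hmain := mutualInfo_prodMk_le_lintegral (S.law σ2 N_e P c) (channelLaw M N_e n ν)
    (X := Prod.fst) measurable_fst (f := fun ω g => S.received c g ω)
    (measurable_received S c) (fun g => ∑ k, ENNReal.ofReal (rateBound σ2 D c₀ q P (g k)))
    (.of_forall fun g => (ENNReal.sum_lt_top.mpr fun _ _ => ENNReal.ofReal_lt_top).ne) (by
      filter_upwards [hae] with g hg
      obtain ⟨h1, h2⟩ := mutualInfo_source_le_logDetBound S hσ hc₀ hD hP hn c hc g hg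
      refine h1.trans ?_
      rw [le_div_iff₀ hn', mul_comm] at h2
      refine (ENNReal.ofReal_le_ofReal h2).trans ?_
      exact Finset.le_sum_of_subadditive ENNReal.ofReal ENNReal.ofReal_zero.le
        (fun _ _ => ENNReal.ofReal_add_le) _ _)
  refine hmain.trans (le_of_eq ?_)
  have hrb := (measurable_rateBound (σ2 := σ2) (c₀ := c₀) (q := q) hDm P).ennreal_ofReal
  rw [lintegral_finsetSum (f := fun k (g : Fin n → Channel M N_e) =>
    ENNReal.ofReal (rateBound σ2 D c₀ q P (g k))) _ fun k _ => hrb.comp (measurable_pi_apply k)]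
  have (k : Fin n) : ∫⁻ g, ENNReal.ofReal (rateBound σ2 D c₀ q P (g k)) ∂(channelLaw M N_e n ν) =
      meanRateBound σ2 D c₀ q ν P :=
    (hev k).lintegral_comp (f := fun h => ENNReal.ofReal (rateBound σ2 D c₀ q P h)) hrb
  simp [this]

lemma measurable_symbols (c : Code S.L n) : Measurable c.symbols := by
  unfold Code.symbols
  fun_prop

lemma measurable_messages {L : Fin 2 → ℕ} (c : Code L n) : Measurable c.messages := by
  unfold Code.messages
  fun_prop

/-- The information bounds concern the whole source, messages together with symbols. The symbols are
a function of it, and so are the messages needed for the converse. -/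
lemma rateGiven_le (P : ℝ) (c : Code S.L n) (g : Fin n → Channel M N_e) :
    S.rateGiven σ2 P c g ≤ mutualInfo (S.law σ2 N_e P c) Prod.fst (S.received c g) / n := by
  unfold JammingScheme.rateGiven
  gcongr
  exact mutualInfo_comp_le _ measurable_fst (measurable_received_apply S c g)
    (measurable_symbols S c)

lemma measurable_observation (c : Code S.L n) :
    Measurable fun ω : (c.Source × Jam S.J n × Block N_e n) × (Fin n → Channel M N_e) =>
      (S.received c ω.2 ω.1, ω.2) :=
  (measurable_received S c).prodMk measurable_snd

lemma rate_le (P : ℝ) (c : Code S.L n) :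
    S.rate σ2 N_e ν P c ≤ mutualInfo ((S.law σ2 N_e P c).prod (channelLaw M N_e n ν))
      (fun ω => ω.1.1) (fun ω => (S.received c ω.2 ω.1, ω.2)) / n := by
  unfold JammingScheme.rate
  gcongr
  exact mutualInfo_comp_le _ measurable_fst.fst (measurable_observation S c)
    (measurable_symbols S c)

end RandomChannel

/-! ### Fano converse for decoded parts of the messages -/

section Converse

variable {M : Fin 2 → ℕ} {N_E N_e n : ℕ} {L : Fin 2 → ℕ}

lemma map_messages_sourceLaw (c : Code L n) : c.sourceLaw.map c.messages =
    Measure.pi fun i => uniformOn (Set.univ : Set (Fin (c.card i))) := by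
  have h (i : Fin 2) : NeZero (c.card i) := ⟨(c.card_pos i).ne'⟩
  have h2 (i : Fin 2) : IsProbabilityMeasure (uniformOn (Set.univ : Set (Fin (c.card i)))) :=
    isProbabilityMeasure_uniformOn Set.finite_univ Set.univ_nonempty
  have h3 := c.markov
  have hfst (i : Fin 2) : ((uniformOn (Set.univ : Set (Fin (c.card i)))) ⊗ₘ (c.enc i)).map
      Prod.fst = uniformOn (Set.univ : Set (Fin (c.card i))) := Measure.fst_compProd _ _
  have h4 (i : Fin 2) : IsProbabilityMeasure
      (((uniformOn (Set.univ : Set (Fin (c.card i)))) ⊗ₘ (c.enc i)).map Prod.fst) := by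
    rw [hfst]; exact h2 i
  have := Measure.pi_map_pi
    (μ := fun i : Fin 2 => (uniformOn (Set.univ : Set (Fin (c.card i)))) ⊗ₘ (c.enc i))
    (f := fun _ => Prod.fst) fun i => measurable_fst.aemeasurable
  simp only [hfst] at this
  exact this

/-- A part of the messages whose fibres have the same size is uniformly distributed. -/
lemma sourceLaw_part_eq (c : Code L n) {m : ℕ} (part : ((i : Fin 2) → Fin (c.card i)) → Fin m)
    (hpart : ∀ b b', (part ⁻¹' {b}).ncard = (part ⁻¹' {b'}).ncard) (b : Fin m) :
    c.sourceLaw {w | part (c.messages w) = b} = (m : ℝ≥0∞)⁻¹ := by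
  have h (i : Fin 2) : NeZero (c.card i) := ⟨(c.card_pos i).ne'⟩
  have h2 (i : Fin 2) : IsProbabilityMeasure (uniformOn (Set.univ : Set (Fin (c.card i)))) :=
    isProbabilityMeasure_uniformOn Set.finite_univ Set.univ_nonempty
  set τ : Measure ((i : Fin 2) → Fin (c.card i)) :=
    Measure.pi fun i => uniformOn (Set.univ : Set (Fin (c.card i))) with hτ
  set κ : ℝ≥0∞ := ∏ i : Fin 2, (c.card i : ℝ≥0∞)⁻¹ with hκ
  have hsing : ∀ x, τ {x} = κ := by
    intro x
    rw [hτ, Measure.pi_singleton]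
    refine Finset.prod_congr rfl fun i _ => ?_
    rw [uniformOn_univ]
    simp
  have hset : ∀ s : Set ((i : Fin 2) → Fin (c.card i)), τ s = s.ncard * κ := by
    intro s
    classical
    have := sum_measure_singleton (μ := τ) (s := s.toFinite.toFinset)
    simp only [hsing, Finset.sum_const, nsmul_eq_mul, Set.Finite.coe_toFinset] at this
    rw [← this, Set.ncard_eq_toFinset_card s]
  have heq : ∀ b', τ (part ⁻¹' {b'}) = τ (part ⁻¹' {b}) := by
    intro b'
    rw [hset, hset, hpart b' b]
  have hsum : ∑ b', τ (part ⁻¹' {b'}) = 1 := by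
    have := sum_measure_preimage_singleton (μ := τ) (f := part) Finset.univ
      fun _ _ => (Set.toFinite _).measurableSet
    rw [this]
    simp
  simp only [heq, Finset.sum_const, Finset.card_univ, Fintype.card_fin, nsmul_eq_mul] at hsum
  have hval : τ (part ⁻¹' {b}) = (m : ℝ≥0∞)⁻¹ := by
    rw [mul_comm] at hsum
    exact ENNReal.eq_inv_of_mul_eq_one_left hsum
  rw [← hval, hτ, ← map_messages_sourceLaw, Measure.map_apply (measurable_messages c)
    (Set.toFinite _).measurableSet]
  rfl

variable (S : JammingScheme M N_E) {σ2 : ℝ≥0} (ν : Measure ℝ) [IsProbabilityMeasure ν]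

/-- The converse: a rate that the eavesdropper can decode is bounded through the information. -/
lemma decodes_rate_le {P ε R : ℝ} (hε0 : 0 ≤ ε) {B : ℝ≥0∞} (hB : B ≠ ∞)
    (hinfo : ∀ n : ℕ, 0 < n → ∀ c : Code S.L n, S.PowerConstraint P c →
      mutualInfo ((S.law σ2 N_e P c).prod (channelLaw M N_e n ν)) (fun ω => ω.1.1)
        (fun ω => (S.received c ω.2 ω.1, ω.2)) ≤ n * B)
    (hdec : S.Decodes σ2 N_e ν P ε R) :
    0 ≤ R ∧ (1 - ε) * R ≤ B.toReal + Real.log 2 := by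
  obtain ⟨n, hn, c, hc, m, part, φ, hpart, hφ, herr, rfl⟩ := hdec
  have hn' : (0 : ℝ) < n := by exact_mod_cast hn
  have hn1 : (1 : ℝ) ≤ n := by exact_mod_cast hn
  have hcard (i : Fin 2) : NeZero (c.card i) := ⟨(c.card_pos i).ne'⟩
  have hm : 0 < m := Fin.pos (part default)
  have hlogm : 0 ≤ Real.log m := Real.log_natCast_nonneg m
  refine ⟨by positivity, ?_⟩
  set μ := (S.law σ2 N_e P c).prod (channelLaw M N_e n ν) with hμ
  have hX : Measurable fun ω : (c.Source × Jam S.J n × Block N_e n) × (Fin n → Channel M N_e) =>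
    ω.1.1 := measurable_fst.fst
  have hY := measurable_observation (N_e := N_e) S c
  set Y := fun ω : (c.Source × Jam S.J n × Block N_e n) × (Fin n → Channel M N_e) =>
    (S.received c ω.2 ω.1, ω.2) with hYdef
  have hI := hinfo n hn c hc
  have hIfin := ne_top_of_le_ne_top (ENNReal.mul_ne_top (ENNReal.natCast_ne_top n) hB) hI
  have hpm : Measurable fun w : c.Source => part (c.messages w) :=
    (measurable_of_countable part).comp (measurable_messages c)
  set E : Set (c.Source × (Block N_e n × (Fin n → Channel M N_e))) :=
    {p | φ p.2 = part (c.messages p.1)} with hE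
  have hEm : MeasurableSet E :=
    measurableSet_eq_fun (hφ.comp measurable_snd) (hpm.comp measurable_fst)
  have hp1 : IsProbabilityMeasure (μ.map fun ω => (ω.1.1, Y ω)) :=
    Measure.isProbabilityMeasure_map (hX.prodMk hY).aemeasurable
  have hp2 : IsProbabilityMeasure (μ.map fun ω => ω.1.1) :=
    Measure.isProbabilityMeasure_map hX.aemeasurable
  have hp3 : IsProbabilityMeasure (μ.map Y) := Measure.isProbabilityMeasure_map hY.aemeasurable
  have hsrc : μ.map (fun ω => ω.1.1) = c.sourceLaw := by
    have h1 : μ.map Prod.fst = S.law σ2 N_e P c := by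
      rw [hμ, ← Measure.fst, Measure.fst_prod]
    have h2 : (S.law σ2 N_e P c).map Prod.fst = c.sourceLaw := by
      rw [JammingScheme.law, ← Measure.fst, Measure.fst_prod]
    rw [← h2, ← h1, Measure.map_map measurable_fst measurable_fst]
    rfl
  -- Under the product law the observation is independent of the messages, so any decoder guesses
  -- the uniform part with probability exactly `1 / m`.
  have hprod : ((μ.map fun ω => ω.1.1).prod (μ.map Y)).real E ≤ 1 / m := by
    have hPE : ((μ.map fun ω => ω.1.1).prod (μ.map Y)) E = (m : ℝ≥0∞)⁻¹ := by
      rw [Measure.prod_apply_symm hEm, hsrc]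
      have hfib : ∀ y, c.sourceLaw ((fun w => (w, y)) ⁻¹' E) = (m : ℝ≥0∞)⁻¹ := by
        intro y
        rw [← sourceLaw_part_eq c part hpart (φ y)]
        congr 1
        ext w
        exact eq_comm
      simp [hfib]
    rw [measureReal_def, hPE]
    simp
  have hjoint : 1 - ε ≤ (μ.map fun ω => (ω.1.1, Y ω)).real E := by
    have h1 : (μ.map fun ω => (ω.1.1, Y ω)) Eᶜ ≤ ENNReal.ofReal ε := by
      rw [Measure.map_apply (hX.prodMk hY) hEm.compl]
      exact herr
    have h2 := probReal_compl_eq_one_sub (μ := μ.map fun ω => (ω.1.1, Y ω)) hEm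
    have h3 : (μ.map fun ω => (ω.1.1, Y ω)).real Eᶜ ≤ ε := ENNReal.toReal_le_of_le_ofReal hε0 h1
    linarith
  have hfano := measureReal_mul_log_sub_log_two_le_klDiv _ _ hIfin hEm hm hprod
  have hle : (mutualInfo μ (fun ω => ω.1.1) Y).toReal ≤ n * B.toReal := by
    have := ENNReal.toReal_mono (ENNReal.mul_ne_top (ENNReal.natCast_ne_top n) hB) hI
    rwa [ENNReal.toReal_mul, ENNReal.toReal_natCast] at this
  have hkl : (1 - ε) * Real.log m - Real.log 2 ≤ n * B.toReal :=
    (sub_le_sub_right (mul_le_mul_of_nonneg_right hjoint hlogm) _).trans (hfano.trans hle)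
  -- Fano's loss `log 2` is divided by `n ≥ 1`, so the final bound is uniform in the block length.
  rw [← mul_div_assoc, div_le_iff₀ hn']
  have hlog2 : 0 ≤ Real.log 2 := Real.log_nonneg (by norm_num)
  nlinarith

end Converse

end Wiretap

/-! ### Assembly of the claims -/

open Wiretap in
theorem proposition1 (M : Fin 2 → ℕ) (N_E N_e : ℕ) (hN : N_e ≤ N_E) (S : JammingScheme M N_E)
    (σ2 : ℝ≥0) (hσ : 0 < σ2) (ν : Measure ℝ) [IsProbabilityMeasure ν] [NullSingletonClass ν]
    (hν : MemLp id 2 ν) :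
    -- given any channel realization that has, in each use, a value in a set `A` of probability one:
    (∃ (A : Set (Channel M N_e)) (C : Channel M N_e → ℝ),
      (∀ᵐ h ∂(channelUseLaw M N_e ν), h ∈ A) ∧
      ∀ n : ℕ, 0 < n → ∀ g : Fin n → Channel M N_e, (∀ k, g k ∈ A) →
        -- the rate is at most a log-det ratio, and this is at most a constant that depends on
        -- neither the power nor the code
        (∀ P : ℝ, 0 < P → ∀ c : Code S.L n, S.PowerConstraint P c →
          S.rateGiven σ2 P c g ≤ ENNReal.ofReal (S.logDetBound σ2 P c g) ∧
          S.logDetBound σ2 P c g ≤ (∑ k, C (g k)) / n) ∧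
        -- zero degrees of freedom
        Tendsto (fun P : ℝ => S.maxRateGiven σ2 g P / ENNReal.ofReal (1 / 2 * Real.log P))
          atTop (𝓝 0)) ∧
    -- the rate for the random channel: bounded by a constant if the entries have a bounded density
    ((∃ K : ℝ≥0, ν ≤ K • volume) →
      ∃ C : ℝ≥0, ∀ P : ℝ, 0 < P → S.maxRate σ2 N_e ν P ≤ C) ∧
    -- zero degrees of freedom for the random channel
    Tendsto (fun P : ℝ => S.maxRate σ2 N_e ν P / ENNReal.ofReal (1 / 2 * Real.log P))
      atTop (𝓝 0) ∧
    -- the messages that the eavesdropper can decode have zero degrees of freedom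
    (∀ ε : ℝ, ε < 1 → ∀ R : ℝ → ℝ, (∀ᶠ P in atTop, S.Decodes σ2 N_e ν P ε (R P)) →
      Tendsto (fun P : ℝ => R P / (1 / 2 * Real.log P)) atTop (𝓝 0)) := by
  obtain ⟨D, c₀, q, hDm, hc₀, hD0, hDlog, hD⟩ := exists_jamming_lower_bound (N_e := N_e) hN S ν
  have hinfo : ∀ P : ℝ, 0 < P → ∀ n : ℕ, 0 < n → ∀ c : Code S.L n, S.PowerConstraint P c →
      mutualInfo ((S.law σ2 N_e P c).prod (channelLaw M N_e n ν)) (fun ω => ω.1.1)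
        (fun ω => (S.received c ω.2 ω.1, ω.2)) ≤ n * meanRateBound σ2 D c₀ q ν P :=
    fun P hP n hn c hc => mutualInfo_source_random_le S ν hσ hc₀ hD hDm hD0 hP hn c hc
  have hmax : ∀ P : ℝ, 0 < P → S.maxRate σ2 N_e ν P ≤ meanRateBound σ2 D c₀ q ν P := by
    intro P hP
    refine iSup₂_le fun n hn => iSup₂_le fun c hc => (rate_le S ν P c).trans ?_
    exact ENNReal.div_le_of_le_mul' (hinfo P hP n hn c hc)
  have hmean := tendsto_meanRateBound_div (σ2 := σ2) (q := q) ν hν hDm hc₀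
  -- The constant is the jamming branch of `rateBound`, finite wherever `D` does not vanish.
  refine ⟨⟨{h | D h ≠ 0}, fun h => N_e / 2 * (Real.log (1 + interferenceRatio D c₀ q h) + 1), hD0,
    fun n hn g hg => ?_⟩, ?_, ?_, ?_⟩
  · have hn' : (0 : ℝ) < n := by exact_mod_cast hn
    have hbound : ∀ P : ℝ, 0 < P → ∀ c : Code S.L n, S.PowerConstraint P c →
        S.rateGiven σ2 P c g ≤ ENNReal.ofReal (S.logDetBound σ2 P c g) ∧
        S.logDetBound σ2 P c g ≤
          (∑ k, (N_e / 2 * (Real.log (1 + interferenceRatio D c₀ q (g k)) + 1))) / n := by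
      intro P hP c hc
      obtain ⟨h1, h2⟩ := mutualInfo_source_le_logDetBound S hσ hc₀ hD hP hn c hc g hg
      refine ⟨(rateGiven_le S P c g).trans (ENNReal.div_le_of_le_mul' (h1.trans ?_)), h2.trans ?_⟩
      · rw [ENNReal.ofReal_mul hn'.le, ENNReal.ofReal_natCast]
      · gcongr with k
        exact rateBound_le_of_interferenceRatio hc₀ hP.le (g k)
    refine ⟨hbound, ?_⟩
    refine tendsto_of_tendsto_of_tendsto_of_le_of_le' tendsto_const_nhds
      (tendsto_const_div_half_log (a := ENNReal.ofReal ((∑ k, (N_e / 2 *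
        (Real.log (1 + interferenceRatio D c₀ q (g k)) + 1))) / n)) ENNReal.ofReal_ne_top)
      (.of_forall fun _ => zero_le) ?_
    filter_upwards [eventually_gt_atTop 0] with P hP
    gcongr
    exact iSup₂_le fun c hc => (hbound P hP c hc).1.trans
      (ENNReal.ofReal_le_ofReal (hbound P hP c hc).2)
  · intro hK
    obtain ⟨C, hC⟩ := exists_meanRateBound_le (σ2 := σ2) (q := q) ν hν hc₀ hD0 (hDlog hK)
    exact ⟨C, fun P hP => (hmax P hP).trans (hC P hP)⟩
  · refine tendsto_of_tendsto_of_tendsto_of_le_of_le' tendsto_const_nhds hmean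
      (.of_forall fun _ => zero_le) ?_
    filter_upwards [eventually_gt_atTop 0] with P hP
    gcongr
    exact hmax P hP
  · intro ε hε R hR
    -- A negative `ε` acts as 0 inside `ENNReal.ofReal`, so it may be replaced by `max ε 0`, which
    -- is still less than 1.
    have hmono : ∀ P r, S.Decodes σ2 N_e ν P ε r → S.Decodes σ2 N_e ν P (max ε 0) r := by
      rintro P r ⟨n, hn, c, hc, m, part, φ, hpart, hφ, herr, hr⟩
      exact ⟨n, hn, c, hc, m, part, φ, hpart, hφ,
        herr.trans (ENNReal.ofReal_le_ofReal (le_max_left _ _)), hr⟩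
    have hε' : 0 < 1 - max ε 0 := by
      have : max ε 0 < 1 := max_lt hε one_pos
      linarith
    have hlim : Tendsto (fun P : ℝ => ((meanRateBound σ2 D c₀ q ν P /
        ENNReal.ofReal (1 / 2 * Real.log P)).toReal + Real.log 2 / (1 / 2 * Real.log P)) /
        (1 - max ε 0)) atTop (𝓝 0) := by
      have h1 := (ENNReal.tendsto_toReal ENNReal.zero_ne_top).comp hmean
      have h2 : Tendsto (fun P : ℝ => Real.log 2 / (1 / 2 * Real.log P)) atTop (𝓝 0) :=
        (Real.tendsto_log_atTop.const_mul_atTop (by norm_num)).const_div_atTop _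
      have := (h1.add h2).div_const (1 - max ε 0)
      simpa using this
    refine tendsto_of_tendsto_of_tendsto_of_le_of_le' tendsto_const_nhds hlim ?_ ?_
    · filter_upwards [hR, eventually_gt_atTop 1] with P hdec hP
      have hlog := Real.log_pos hP
      have h := decodes_rate_le S ν (le_max_right ε 0) (meanRateBound_ne_top ν hν hc₀ hP.le)
        (hinfo P (by linarith)) (hmono _ _ hdec)
      exact div_nonneg h.1 (by positivity)
    · filter_upwards [hR, eventually_gt_atTop 1] with P hdec hP
      have hlog := Real.log_pos hP
      have h := decodes_rate_le S ν (le_max_right ε 0) (meanRateBound_ne_top ν hν hc₀ hP.le)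
        (hinfo P (by linarith)) (hmono _ _ hdec)
      rw [ENNReal.toReal_div, ENNReal.toReal_ofReal (by positivity), ← add_div, le_div_iff₀ hε',
        div_mul_eq_mul_div]
      gcongr
      linarith [h.2]
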